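/- Let $\Lambda$ be the ring of symmetric functions over $\mathbb{Q}$ in $x_1,x_2,\dots$, with monomial symmetric functions $\mathrm{m}_\lambda$, complete homogeneous symmetric functions $\mathrm{h}_\lambda=\mathrm{h}_{\lambda_1}\mathrm{h}_{\lambda_2}\cdots$ and skew Schur functions $\mathrm{s}_{\lambda/\mu}=\sum_{T\in \mathrm{SSYT}(\lambda/\mu)}\mathbf{x}^T$, where $\mathrm{s}_\lambda=\mathrm{s}_{\lambda/\emptyset}$. The Hall inner product on $\Lambda$ is the unique bilinear form with $\langle \mathrm{m}_\lambda,\mathrm{h}_\mu\rangle=\delta_{\lambda\mu}$. For an integer $k\ge 1$ let $\rho_k:\Lambda\to\Lambda$ be the linear map with $\rho_k(\mathrm{m}_\mu)=\mathrm{m}_{\mu/k}$ if all parts of $\mu$ are divisible by $k$, and $\rho_k(\mathrm{m}_\mu)=0$ otherwise. **Proposition.** The map $\rho_k$ has a unique adjoint $\rho_k^\perp$ with respect to the Hall inner product, that is, $\langle\rho_k(f),g\rangle=\langle f,\rho_k^\perp(g)\rangle$ for all $f,g\in\Lambda$; it is the unique $\mathbb{Q}$-algebra homomorphism $\Lambda\to\Lambda$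 with $\rho_k^\perp(\mathrm{h}_r)=\mathrm{h}_{kr}$ for all $r\ge 0$. Let $\mu\subseteq\lambda$ be partitions with $|\lambda|-|\mu|=n$, let $\ell$ be the number of parts of $\lambda$, and put $\rho=(\ell-1,\ell-2,\dots,1,0)$. Then $$\rho_k^\perp(\mathrm{s}_{\lambda/\mu})=\mathrm{s}_{(k\lambda+(k-1)\rho)/(k\mu+(k-1)\rho)} =\sum_{\nu\vdash kn} c^{\,k\lambda+(k-1)\rho}_{\,k\mu+(k-1)\rho,\;\nu}\,\mathrm{s}_\nu .$$ In particular, for $\lambda\vdash n$, $$\rho_k^\perp(\mathrm{s}_{\lambda})=\sum_{\nu\vdash kn} c^{\,k\lambda+(k-1)\rho}_{\,(k-1)\rho,\;\nu}\,\mathrm{s}_\nu .$$ Here the Littlewood–Richardson coefficient $c^{\alpha}_{\beta,\nu}$ is the number of semistandard Young tableaux of skew shape $\alpha/\beta$ and content $\nu$ whose reverse reading word (rows from top to bottom, each row from right to left) is a ballot word, i.e. every prefix contains at least as many letters $i$ as letters $i+1$, for every $i\ge 1$. -/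

import Mathlib

noncomputable section

namespace SymF

/-! ### The ring of symmetric functions -/

/-- The ring `Λ` of symmetric functions over `ℚ`: the power series in the variables
`x_0, x_1, x_2, …` that are of bounded degree and invariant under all permutations of the
variables. (Variables, and the entries of tableaux below, are numbered from `0`.) -/
def Sym : Subalgebra ℚ (MvPowerSeries ℕ ℚ) where
  carrier := {f | (∃ N : ℕ, ∀ d : ℕ →₀ ℕ, N < d.degree → MvPowerSeries.coeff d f = 0) ∧
    ∀ σ : Equiv.Perm ℕ, MvPowerSeries.renameEquiv ℚ σ f = f}
  mul_mem' := by
    rintro f g ⟨⟨M, hM⟩, hf⟩ ⟨⟨N, hN⟩, hg⟩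
    refine ⟨⟨M + N, fun d hd => ?_⟩, fun σ => by rw [map_mul, hf, hg]⟩
    classical
    rw [MvPowerSeries.coeff_mul]
    refine Finset.sum_eq_zero fun p hp => ?_
    have h : p.1.degree + p.2.degree = d.degree := by
      rw [← map_add, Finset.HasAntidiagonal.mem_antidiagonal.mp hp]
    rcases lt_or_ge M p.1.degree with h1 | h1
    · rw [hM _ h1, zero_mul]
    · rw [hN _ (by omega), mul_zero]
  add_mem' := by
    rintro f g ⟨⟨M, hM⟩, hf⟩ ⟨⟨N, hN⟩, hg⟩
    refine ⟨⟨max M N, fun d hd => ?_⟩, fun σ => by rw [map_add, hf, hg]⟩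
    rw [map_add, hM _ (lt_of_le_of_lt (le_max_left _ _) hd),
      hN _ (lt_of_le_of_lt (le_max_right _ _) hd), add_zero]
  algebraMap_mem' := by
    intro r
    refine ⟨⟨0, fun d hd => ?_⟩, fun σ => AlgEquiv.commutes _ r⟩
    classical
    rw [MvPowerSeries.algebraMap_apply, MvPowerSeries.coeff_C, if_neg]
    rintro rfl
    simp at hd

theorem coeff_renameEquiv (σ : Equiv.Perm ℕ) (f : MvPowerSeries ℕ ℚ) (d : ℕ →₀ ℕ) :
    MvPowerSeries.coeff d (MvPowerSeries.renameEquiv ℚ σ f) =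
      MvPowerSeries.coeff (Finsupp.equivMapDomain σ.symm d) f := by
  have h := MvPowerSeries.coeff_embDomain_rename (R := ℚ) σ.toEmbedding f
    (Finsupp.equivMapDomain σ.symm d)
  have hd : Finsupp.embDomain σ.toEmbedding (Finsupp.equivMapDomain σ.symm d) = d := by
    rw [Finsupp.embDomain_eq_mapDomain]
    change Finsupp.mapDomain σ _ = d
    rw [← Finsupp.equivMapDomain_eq_mapDomain]
    ext i
    simp [Finsupp.equivMapDomain_apply]
  rw [hd] at h
  exact h

/-- Invariance of a power series read off its coefficients. -/
theorem mem_Sym_of_coeff {f : MvPowerSeries ℕ ℚ} (N : ℕ)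
    (hN : ∀ d : ℕ →₀ ℕ, N < d.degree → MvPowerSeries.coeff d f = 0)
    (hσ : ∀ (σ : Equiv.Perm ℕ) (d : ℕ →₀ ℕ),
      MvPowerSeries.coeff (Finsupp.equivMapDomain σ d) f = MvPowerSeries.coeff d f) :
    f ∈ Sym :=
  ⟨⟨N, hN⟩, fun σ => by ext d; rw [coeff_renameEquiv, hσ]⟩

theorem coeff_equivMapDomain (f : Sym) (σ : Equiv.Perm ℕ) (d : ℕ →₀ ℕ) :
    MvPowerSeries.coeff (Finsupp.equivMapDomain σ d) (f : MvPowerSeries ℕ ℚ) =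
      MvPowerSeries.coeff d (f : MvPowerSeries ℕ ℚ) := by
  have h := congrArg (MvPowerSeries.coeff d) (f.2.2 σ.symm)
  rw [coeff_renameEquiv] at h
  simpa using h

theorem degree_equivMapDomain (σ : Equiv.Perm ℕ) (d : ℕ →₀ ℕ) :
    (Finsupp.equivMapDomain σ d).degree = d.degree := by
  rw [Finsupp.equivMapDomain_eq_mapDomain, Finsupp.degree_mapDomain]

/-- The multiset of nonzero exponents of the monomial `x^d`. -/
def exponents (d : ℕ →₀ ℕ) : Multiset ℕ := d.support.val.map d

theorem exponents_equivMapDomain (σ : Equiv.Perm ℕ) (d : ℕ →₀ ℕ) :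
    exponents (Finsupp.equivMapDomain σ d) = exponents d := by
  have h : (Finsupp.equivMapDomain σ d).support = d.support.map σ.toEmbedding := rfl
  rw [exponents, h, Finset.map_val, Multiset.map_map]
  refine Multiset.map_congr rfl fun i _ => ?_
  simp [Finsupp.equivMapDomain_apply]

theorem exponents_sum (d : ℕ →₀ ℕ) : (exponents d).sum = d.degree := rfl

open Classical in
/-- The monomial symmetric function `m_lam`: the sum of all distinct monomials whose nonzero
exponents are, up to order, the parts of the partition `lam`. -/
def mSym (lam : YoungDiagram) : Sym :=
  ⟨fun d => if exponents d = (lam.rowLens : Multiset ℕ) then 1 else 0,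
    mem_Sym_of_coeff (lam.rowLens : Multiset ℕ).sum
      (fun d hd => if_neg fun h => by rw [← exponents_sum, h] at hd; exact lt_irrefl _ hd)
      (fun σ d => by
        change (if exponents (Finsupp.equivMapDomain σ d) = _ then (1 : ℚ) else 0) = _
        rw [exponents_equivMapDomain]; rfl)⟩

/-- The complete homogeneous symmetric function `h_r`: the sum of all monomials of degree `r`. -/
def hSym (r : ℕ) : Sym :=
  ⟨fun d => if d.degree = r then 1 else 0,
    mem_Sym_of_coeff r (fun _ hd => if_neg hd.ne')
      (fun σ d => by
        change (if (Finsupp.equivMapDomain σ d).degree = r then (1 : ℚ) else 0) = _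
        rw [degree_equivMapDomain]; rfl)⟩

/-- `h_lam = h_{lam_1} h_{lam_2} ⋯`. -/
def hPart (lam : YoungDiagram) : Sym := (lam.rowLens.map hSym).prod

open Classical in
/-- `B` is the Hall inner product: `⟨m_lam, h_mu⟩ = δ_{lam, mu}`. -/
def IsHallForm (B : LinearMap.BilinForm ℚ Sym) : Prop :=
  ∀ lam mu : YoungDiagram, B (mSym lam) (hPart mu) = if lam = mu then 1 else 0

/-! ### The partition division map -/

/-- The linear map `ρ_k` with `ρ_k (m_mu) = m_{mu / k}` if all parts of `mu` are divisible by `k`,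
and `ρ_k (m_mu) = 0` otherwise: the coefficient of `x^d` in `ρ_k f` is that of `x^{k d}` in `f`. -/
def rowMap (k : ℕ) (hk : 0 < k) : Sym →ₗ[ℚ] Sym where
  toFun f := ⟨fun d => MvPowerSeries.coeff (k • d) (f : MvPowerSeries ℕ ℚ), by
    obtain ⟨N, hN⟩ := f.2.1
    refine mem_Sym_of_coeff N (fun d hd => hN _ ?_) (fun σ d => ?_)
    · rw [map_nsmul, smul_eq_mul]
      exact lt_of_lt_of_le hd (Nat.le_mul_of_pos_left _ hk)
    · have e : k • Finsupp.equivMapDomain σ d = Finsupp.equivMapDomain σ (k • d) := by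
        ext i; simp [Finsupp.equivMapDomain_apply]
      change MvPowerSeries.coeff (k • Finsupp.equivMapDomain σ d) (f : MvPowerSeries ℕ ℚ) = _
      rw [e]
      exact coeff_equivMapDomain f σ (k • d)⟩
  map_add' _ _ := rfl
  map_smul' _ _ := rfl

theorem exponents_nsmul (k : ℕ) (hk : 0 < k) (d : ℕ →₀ ℕ) :
    exponents (k • d) = (exponents d).map (k * ·) := by
  rw [exponents, Finsupp.support_smul_eq hk.ne', exponents, Multiset.map_map]
  rfl

/-- `ρ_k (m_{k nu}) = m_nu`. -/
theorem rowMap_m (k : ℕ) (hk : 0 < k) (mu nu : YoungDiagram)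
    (hmu : mu.rowLens = nu.rowLens.map (k * ·)) : rowMap k hk (mSym mu) = mSym nu := by
  classical
  ext d
  change (if exponents (k • d) = (mu.rowLens : Multiset ℕ) then (1 : ℚ) else 0) =
    if exponents d = (nu.rowLens : Multiset ℕ) then 1 else 0
  have e : exponents (k • d) = (mu.rowLens : Multiset ℕ) ↔
      exponents d = (nu.rowLens : Multiset ℕ) := by
    rw [exponents_nsmul k hk, hmu, ← Multiset.map_coe]
    exact (Multiset.map_injective fun _ _ h => Nat.eq_of_mul_eq_mul_left hk h).eq_iff
  simp only [e]

/-- `ρ_k (m_mu) = 0` if some part of `mu` is not divisible by `k`. -/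
theorem rowMap_m_eq_zero (k : ℕ) (hk : 0 < k) (mu : YoungDiagram)
    (hmu : ∃ x ∈ mu.rowLens, ¬ k ∣ x) : rowMap k hk (mSym mu) = 0 := by
  classical
  obtain ⟨x, hx, hkx⟩ := hmu
  ext d
  change (if exponents (k • d) = (mu.rowLens : Multiset ℕ) then (1 : ℚ) else 0) = 0
  refine if_neg fun h => hkx ?_
  rw [← Multiset.mem_coe, ← h, exponents_nsmul k hk, Multiset.mem_map] at hx
  obtain ⟨y, -, rfl⟩ := hx
  exact Dvd.intro _ rfl

/-! ### Skew tableaux, skew Schur functions, Littlewood–Richardson coefficients -/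

/-- Semistandard Young tableaux of skew shape `lam / mu`: fillings of the cells of `lam` outside
`mu` that increase weakly along rows and strictly down columns. As for Mathlib's
`SemistandardYoungTableau`, the entry outside the shape is `0` by convention. -/
@[ext]
structure SkewSSYT (lam mu : YoungDiagram) where
  entry : ℕ → ℕ → ℕ
  row_weak : ∀ {i j₁ j₂ : ℕ}, j₁ < j₂ → (i, j₁) ∈ lam.cells \ mu.cells →
    (i, j₂) ∈ lam.cells \ mu.cells → entry i j₁ ≤ entry i j₂
  col_strict : ∀ {i₁ i₂ j : ℕ}, i₁ < i₂ → (i₁, j) ∈ lam.cells \ mu.cells →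
    (i₂, j) ∈ lam.cells \ mu.cells → entry i₁ j < entry i₂ j
  zeros : ∀ {i j : ℕ}, (i, j) ∉ lam.cells \ mu.cells → entry i j = 0

namespace SkewSSYT

variable {lam mu : YoungDiagram}

/-- The content of a tableau: `T.content a` is the number of cells with entry `a`. -/
def content (T : SkewSSYT lam mu) : ℕ →₀ ℕ :=
  ∑ c ∈ lam.cells \ mu.cells, Finsupp.single (T.entry c.1 c.2) 1

/-- The reverse reading word: rows from top to bottom, each row from right to left. -/
def reverseReadingWord (T : SkewSSYT lam mu) : List ℕ :=
  (List.range (lam.colLen 0)).flatMap fun i =>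
    ((List.range' (mu.rowLen i) (lam.rowLen i - mu.rowLen i)).map (T.entry i)).reverse

end SkewSSYT

/-- A ballot word: every prefix contains at least as many letters `a` as letters `a + 1`. -/
def IsBallot (w : List ℕ) : Prop :=
  ∀ v : List ℕ, v <+: w → ∀ a : ℕ, v.count (a + 1) ≤ v.count a

/-- The skew Schur function `s_{lam / mu} = ∑_T x^T`: the coefficient of `x^d` is the number of
semistandard tableaux of shape `lam / mu` and content `d`. -/
def skewSchur (lam mu : YoungDiagram) : MvPowerSeries ℕ ℚ :=
  fun d => (Nat.card {T : SkewSSYT lam mu // T.content = d} : ℚ)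

/-- The Schur function `s_lam`. -/
def schur (lam : YoungDiagram) : MvPowerSeries ℕ ℚ := skewSchur lam ⊥

/-- The Littlewood–Richardson coefficient `c^lam_{mu, nu}`: the number of semistandard tableaux of
shape `lam / mu` and content `nu` whose reverse reading word is a ballot word. -/
def lrCoeff (lam mu nu : YoungDiagram) : ℕ :=
  Nat.card {T : SkewSSYT lam mu // (∀ a, T.content a = nu.rowLen a) ∧
    IsBallot T.reverseReadingWord}

/-! ### Partitions -/

/-- The Young diagram of a partition of `n`. -/
def diagram {n : ℕ} (p : n.Partition) : YoungDiagram :=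
  YoungDiagram.ofRowLens (p.parts.sort (· ≥ ·)) (p.parts.pairwise_sort (· ≥ ·)).sortedGE

/-- The partition `k mu + (k - 1) ρ` with `ρ = (ℓ - 1, ℓ - 2, …, 1, 0)`, for `mu` with at most `ℓ`
parts (padded with zeros) and `k ≥ 1`. In particular it is `(k - 1) ρ` for `mu = ∅`. -/
def dilateShift (k l : ℕ) (mu : YoungDiagram) : YoungDiagram :=
  YoungDiagram.ofRowLens ((List.range l).map fun i => k * mu.rowLen i + (k - 1) * (l - 1 - i))
    (List.pairwise_le_range.map _ fun i j hij => by
      have h := mu.rowLen_anti i j hij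
      have h' : l - 1 - j ≤ l - 1 - i := by omega
      gcongr).sortedGE

end SymF

end

/-! Pairing `f` with `h_μ` reads off the coefficient of `x^μ` in `f`. Hence `⟨ρ_k f, h_μ⟩` is the
coefficient of `x^{kμ}` in `f`, that is `⟨f, h_{kμ}⟩`, and the adjoint has to send `h_μ` to
`h_{kμ}`; this rule is multiplicative (`IsHallForm.apply_dilateHom`). By Jacobi-Trudi, `s_{λ/μ}` is
the determinant of the `h_{(λ+ρ)_i - (μ+ρ)_j}` (`skewSchur_eq_det`). Applying `h_r ↦ h_{kr}`
entrywise multiplies `λ+ρ` and `μ+ρ` by `k`, and `k(λ+ρ) = (kλ+(k-1)ρ)+ρ` (`shifted_dilateShift`),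
so the result is the Jacobi-Trudi determinant of the dilated skew shape. Its Schur expansion is the
Littlewood-Richardson rule (`skewSchur_eq_sum_lrCoeff`).

The classical inputs are proved in `N` variables, with tableaux encoded as chains of partitions
growing by horizontal strips. Jacobi-Trudi goes by induction on `N`: dropping the last letter peels
off a strip, while row operations expand the determinant over sequences interlacing `λ+ρ`; adding
`ρ` identifies the two sums (`det_completeHSub_succ`, `chainSum_strips_eq`). Symmetry of skew Schur
functions is a consequence.

For the Littlewood-Richardson rule (Stembridge's argument), symmetry gives `s_{λ/μ} a_ρ` as the sum
of the alternants `a_{wt(c)+ρ}` over all chains `c`. A Bender-Knuth toggle of the columns before the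
last offending column changes the sign of the alternant, so only ballot chains survive
(`sum_alternant_eq_sum_good`). For a straight shape exactly one survives, which gives `s_ν a_ρ =
a_{ν+ρ}`; cancelling `a_ρ` yields the rule.

The same formula makes Schur functions linearly independent. Dimension counts in bounded degree,
together with Jacobi-Trudi, show that the `h_λ` form a basis, and this gives existence, uniqueness
and nondegeneracy of the Hall form. -/

noncomputable section
namespace SymF

/-! ### Complete homogeneous polynomials in finitely many variables -/

section CompleteHomogeneous

variable {R : Type*} [CommRing R]

/-- The complete homogeneous polynomial of degree `r` evaluated at `x`. -/
def completeH {N : ℕ} (x : Fin N → R) (r : ℕ) : R :=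
  PowerSeries.coeff r (∏ a, PowerSeries.mk fun n => x a ^ n)

/-- `h_{a - b}`, which is `0` for `a < b`. -/
def completeHSub {N : ℕ} (x : Fin N → R) (a b : ℕ) : R :=
  if b ≤ a then completeH x (a - b) else 0

theorem completeH_zero {N : ℕ} (x : Fin N → R) : completeH x 0 = 1 := by
  simp [completeH, map_prod]

theorem completeH_comp_perm {N : ℕ} (x : Fin N → R) (σ : Equiv.Perm (Fin N)) (r : ℕ) :
    completeH (x ∘ σ) r = completeH x r := by
  rw [completeH, completeH]
  congr 1
  exact Equiv.prod_comp σ fun a => PowerSeries.mk fun n => x a ^ n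

theorem mk_pow_eq (z : R) : (PowerSeries.mk fun n => z ^ n) =
    1 + PowerSeries.C z * (PowerSeries.X * PowerSeries.mk fun n => z ^ n) := by
  ext n
  cases n with
  | zero => simp
  | succ n => simp [PowerSeries.coeff_succ_X_mul, PowerSeries.coeff_one, pow_succ']

/-- A monomial of degree `r + 1` either contains the last variable, which can be divided out once,
or does not contain it. -/
theorem completeH_succ {N : ℕ} (x : Fin (N + 1) → R) (r : ℕ) :
    completeH x (r + 1) =
      x (Fin.last N) * completeH x r + completeH (fun i => x i.castSucc) (r + 1) := by
  simp only [completeH, Fin.prod_univ_castSucc]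
  set P := ∏ a : Fin N, PowerSeries.mk fun n => x a.castSucc ^ n
  set z := x (Fin.last N)
  conv_lhs => rw [mk_pow_eq, show P * (1 + PowerSeries.C z *
    (PowerSeries.X * PowerSeries.mk fun n => z ^ n)) = P + PowerSeries.C z *
    (PowerSeries.X * (P * PowerSeries.mk fun n => z ^ n)) by ring]
  rw [map_add, PowerSeries.coeff_C_mul, PowerSeries.coeff_succ_X_mul, add_comm]

/-- The recursion survives at the boundary `b = a + 1`, because `h_0 = 1` in any number of variables
and `h_{-1} = 0`. -/
theorem completeHSub_succ {N : ℕ} (x : Fin (N + 1) → R) (a b : ℕ) :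
    completeHSub x (a + 1) b =
      x (Fin.last N) * completeHSub x a b + completeHSub (fun i => x i.castSucc) (a + 1) b := by
  rcases lt_trichotomy b (a + 1) with h | rfl | h
  · rw [completeHSub, completeHSub, completeHSub, if_pos (by omega), if_pos (by omega),
      if_pos (by omega), show a + 1 - b = a - b + 1 by omega, completeH_succ]
  · simp [completeHSub, completeH_zero]
  · rw [completeHSub, completeHSub, completeHSub, if_neg (by omega), if_neg (by omega),
      if_neg (by omega), mul_zero, add_zero]

/-- This is the recursion iterated from `a` down to `a'`. The last term is a multiple of the entry
with index `a'` in the same column, so a row operation removes it from the Jacobi-Trudi determinant.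
-/
theorem completeHSub_sum_Ioc {N : ℕ} (x : Fin (N + 1) → R) {a a' : ℕ} (h : a' ≤ a) (b : ℕ) :
    completeHSub x a b = ∑ c ∈ Finset.Ioc a' a, x (Fin.last N) ^ (a - c) *
      completeHSub (fun i => x i.castSucc) c b + x (Fin.last N) ^ (a - a') * completeHSub x a' b := by
  induction a, h using Nat.le_induction with
  | base => simp
  | succ a h ih =>
    rw [completeHSub_succ, ih, ← Finset.insert_Ioc_right_eq_Ioc_add_one h,
      Finset.sum_insert (by simp), mul_add, Finset.mul_sum]
    have e : ∀ c ∈ Finset.Ioc a' a, x (Fin.last N) ^ (a + 1 - c) *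
        completeHSub (fun i => x i.castSucc) c b = x (Fin.last N) * (x (Fin.last N) ^ (a - c) *
        completeHSub (fun i => x i.castSucc) c b) := fun c hc => by
      rw [show a + 1 - c = a - c + 1 by have := Finset.mem_Ioc.mp hc; omega, pow_succ']
      ring
    rw [Finset.sum_congr rfl e, show a + 1 - a' = a - a' + 1 by omega, Nat.sub_self, pow_zero]
    ring

theorem completeHSub_sum_Iic {N : ℕ} (x : Fin (N + 1) → R) (a b : ℕ) :
    completeHSub x a b = ∑ c ∈ Finset.Iic a, x (Fin.last N) ^ (a - c) *
      completeHSub (fun i => x i.castSucc) c b := by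
  have h0 : completeHSub x 0 b = completeHSub (fun i => x i.castSucc) 0 b := by
    by_cases hb : b = 0
    · subst hb; simp [completeHSub, completeH_zero]
    · rw [completeHSub, completeHSub, if_neg (by omega), if_neg (by omega)]
  have e : Finset.Iic a = insert 0 (Finset.Ioc 0 a) := by
    ext c; simp only [Finset.mem_Iic, Finset.mem_insert, Finset.mem_Ioc]; omega
  rw [completeHSub_sum_Ioc x (Nat.zero_le a), e, Finset.sum_insert (by simp), h0, add_comm]

/-- The exponents that interlace a weakly increasing sequence `v`. -/
def interlacing {n : ℕ} (v : Fin (n + 1) → ℕ) : Fin (n + 1) → Finset ℕ :=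
  Fin.cases (Finset.Iic (v 0)) fun i => Finset.Ioc (v i.castSucc) (v i.succ)

/-- Removing one variable from a determinant of complete homogeneous polynomials. -/
theorem det_completeHSub_succ {N n : ℕ} (x : Fin (N + 1) → R) (v u : Fin (n + 1) → ℕ)
    (hv : Monotone v) :
    (Matrix.of fun i j => completeHSub x (v i) (u j)).det =
      ∑ c ∈ Fintype.piFinset (interlacing v), x (Fin.last N) ^ (∑ i, (v i - c i)) *
        (Matrix.of fun i j => completeHSub (fun a => x a.castSucc) (c i) (u j)).det := by
  set z := x (Fin.last N)
  set y : Fin N → R := fun a => x a.castSucc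
  have h1 : (Matrix.of fun i j => completeHSub x (v i) (u j)).det =
      (Matrix.of fun i => ∑ c ∈ interlacing v i,
        z ^ (v i - c) • fun j => completeHSub y c (u j)).det := by
    -- Subtract from each row a power of `z` times its predecessor; what remains is a sum over the
    -- gap between two consecutive exponents. The first row is expanded all the way down to `0`.
    refine Matrix.det_eq_of_forall_row_eq_smul_add_pred
      (fun i => z ^ (v i.succ - v i.castSucc)) (fun j => ?_) fun i j => ?_
    · simp only [Matrix.of_apply, Finset.sum_apply, Pi.smul_apply, smul_eq_mul]
      exact completeHSub_sum_Iic x _ _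
    · simp only [Matrix.of_apply, Finset.sum_apply, Pi.smul_apply, smul_eq_mul]
      exact completeHSub_sum_Ioc x (hv (Fin.castSucc_lt_succ (i := i)).le) _
  rw [h1]
  -- Multilinearity in the rows turns the row sums into a single sum over choices of one exponent
  -- per gap.
  have h2 := (Matrix.detRowAlternating (n := Fin (n + 1)) (R := R)).toMultilinearMap.map_sum_finset
    (fun i c => z ^ (v i - c) • fun j => completeHSub y c (u j)) (interlacing v)
  refine h2.trans (Finset.sum_congr rfl fun c _ => ?_)
  rw [MultilinearMap.map_smul_univ, Finset.prod_pow_eq_pow_sum]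
  rfl

theorem completeHSub_fin_zero (x : Fin 0 → R) (a b : ℕ) :
    completeHSub x a b = if a = b then 1 else 0 := by
  by_cases h : a = b
  · subst h; simp [completeHSub, completeH_zero]
  · rw [if_neg h, completeHSub]
    split_ifs with h'
    · rw [completeH, Finset.univ_eq_empty, Finset.prod_empty, PowerSeries.coeff_one,
        if_neg (by omega)]
    · rfl

/-- If every `v i` occurs among the `u j`, the reindexing is a strictly increasing self-map of `Fin
n`, hence the identity. So `v ≠ u` forces a zero row. -/
theorem det_ite_eq {n : ℕ} {v u : Fin n → ℕ} (hv : StrictMono v) (hu : StrictMono u) :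
    (Matrix.of fun i j => if v i = u j then (1 : R) else 0).det = if v = u then 1 else 0 := by
  split_ifs with h
  · subst h
    rw [← Matrix.det_one (n := Fin n)]
    congr 1
    ext i j
    simp [Matrix.one_apply, hv.injective.eq_iff]
  · have : ∃ i, ∀ j, v i ≠ u j := by
      by_contra! H
      choose f hf using H
      have hf' : StrictMono f := fun a b hab => by
        have := hv hab; rw [hf, hf] at this; exact hu.lt_iff_lt.mp this
      have hid : ∀ i, f i = i := fun i => congrFun (congrArg DFunLike.coe
          (Subsingleton.elim (hf'.orderIsoOfSurjective f
            (Finite.surjective_of_injective hf'.injective)) (OrderIso.refl _))) i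
      exact h (funext fun i => by rw [hf, hid])
    obtain ⟨i, hi⟩ := this
    exact Matrix.det_eq_zero_of_row_eq_zero i fun j => by simp [hi j]

end CompleteHomogeneous


/-! ### Chains of horizontal strips -/

/-- A chain `mu = c_0 ⊆ c_1 ⊆ ⋯ ⊆ c_N = lam` of partitions with at most `l` parts, each step being
a horizontal strip. It encodes the semistandard tableau of shape `lam / mu` whose entries smaller
than `a` fill `c_a / mu`. -/
@[ext]
structure Chain (N l : ℕ) (lam mu : ℕ → ℕ) where
  val : ℕ → ℕ → ℕ
  zero : ∀ i, val 0 i = mu i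
  last : ∀ a, N ≤ a → ∀ i, val a i = lam i
  mono : ∀ a i, val a i ≤ val (a + 1) i
  strip : ∀ a i, val (a + 1) (i + 1) ≤ val a i
  bdd : ∀ a i, l ≤ i → val a i = 0

namespace Chain

variable {N l : ℕ} {lam mu : ℕ → ℕ}

theorem anti (c : Chain N l lam mu) (a : ℕ) : Antitone (c.val a) :=
  antitone_nat_of_succ_le fun i => (c.mono a (i + 1)).trans (c.strip a i)

theorem monotone (c : Chain N l lam mu) (i : ℕ) : Monotone fun a => c.val a i :=
  monotone_nat_of_le_succ fun a => c.mono a i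

theorem le_last (c : Chain N l lam mu) (a i : ℕ) : c.val a i ≤ lam i := by
  rw [← c.last (max a N) (le_max_right _ _) i]
  exact c.monotone i (le_max_left _ _)

/-- The number of letters `a`. -/
def wt (c : Chain N l lam mu) (a : ℕ) : ℕ := ∑ i ∈ Finset.range l, (c.val (a + 1) i - c.val a i)

theorem wt_of_le (c : Chain N l lam mu) {a : ℕ} (h : N ≤ a) : c.wt a = 0 :=
  Finset.sum_eq_zero fun i _ => by rw [c.last a h, c.last (a + 1) (by omega), Nat.sub_self]

instance : Finite (Chain N l lam mu) := by
  let f : Chain N l lam mu → Fin N → Fin l → Fin (∑ i ∈ Finset.range l, lam i + 1) :=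
    fun c a i => ⟨c.val a i, Nat.lt_succ_of_le ((c.le_last a i).trans
      (Finset.single_le_sum (f := lam) (fun _ _ => Nat.zero_le _) (Finset.mem_range.mpr i.2)))⟩
  refine Finite.of_injective f fun c c' h => ?_
  ext a i
  by_cases ha : a < N
  · by_cases hi : i < l
    · exact congrArg Fin.val (congrFun (congrFun h ⟨a, ha⟩) ⟨i, hi⟩)
    · rw [c.bdd a i (by omega), c'.bdd a i (by omega)]
  · rw [c.last a (by omega), c'.last a (by omega)]

instance : Fintype (Chain N l lam mu) := Fintype.ofFinite _

/-- Forget the letters `N`. -/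
def init (c : Chain (N + 1) l lam mu) : Chain N l (c.val N) mu where
  val a i := c.val (min a N) i
  zero i := by rw [Nat.zero_min, c.zero]
  last a ha i := by rw [min_eq_right ha]
  mono a i := c.monotone i (by omega)
  strip a i := by
    rcases le_or_gt N a with h | h
    · rw [min_eq_right h, min_eq_right (by omega)]
      exact c.anti _ (Nat.le_succ i)
    · rw [min_eq_left h.le, min_eq_left (by omega)]
      exact c.strip a i
  bdd a i h := c.bdd _ i h

/-- Append a horizontal strip of letters `N`. -/
def snoc {κ : ℕ → ℕ} (c : Chain N l κ mu) (hl : ∀ i, l ≤ i → lam i = 0) (h1 : ∀ i, κ i ≤ lam i)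
    (h2 : ∀ i, lam (i + 1) ≤ κ i) : Chain (N + 1) l lam mu where
  val a i := if a ≤ N then c.val a i else lam i
  zero i := by rw [if_pos (Nat.zero_le _), c.zero]
  last a ha i := by rw [if_neg (by omega)]
  mono a i := by
    split_ifs
    · exact c.mono a i
    · exact (c.le_last a i).trans (h1 i)
    · omega
    · exact le_rfl
  strip a i := by
    split_ifs with h h'
    · exact c.strip a i
    · omega
    · rw [show a = N by omega, c.last N le_rfl]; exact h2 i
    · exact (h2 i).trans (h1 i)
  bdd a i h := by
    split_ifs
    · exact c.bdd a i h
    · exact hl i h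

end Chain

/-- Extension by zero of a finite sequence. -/
def extendZero {l : ℕ} (κ : Fin l → ℕ) (i : ℕ) : ℕ := if h : i < l then κ ⟨i, h⟩ else 0

theorem extendZero_of_lt {l : ℕ} (κ : Fin l → ℕ) (i : Fin l) : extendZero κ i = κ i := by
  simp [extendZero]

theorem extendZero_of_le {l : ℕ} (κ : Fin l → ℕ) {i : ℕ} (h : l ≤ i) : extendZero κ i = 0 := by
  rw [extendZero, dif_neg (by omega)]

theorem extendZero_restrict {l : ℕ} (f : ℕ → ℕ) (h : ∀ i, l ≤ i → f i = 0) :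
    extendZero (fun i : Fin l => f i) = f := by
  funext i
  by_cases hi : i < l
  · rw [extendZero, dif_pos hi]
  · rw [extendZero_of_le _ (by omega), h i (by omega)]

/-- The partitions `κ` such that `lam / κ` is a horizontal strip. -/
def stripsBelow (l : ℕ) (lam : ℕ → ℕ) : Finset (Fin l → ℕ) :=
  Fintype.piFinset fun i : Fin l => Finset.Icc (lam (i + 1)) (lam i)

/-! ### Skew Schur polynomials and the Jacobi-Trudi determinant. -/

section ChainSum

variable {R : Type*} [CommRing R]

/-- The skew Schur polynomial evaluated at `x`. -/
def chainSum {N : ℕ} (x : Fin N → R) (l : ℕ) (lam mu : ℕ → ℕ) : R :=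
  ∑ c : Chain N l lam mu, ∏ a : Fin N, x a ^ c.wt a

theorem sigma_chain_ext {N l : ℕ} {mu : ℕ → ℕ} {p q : Σ κ : Fin l → ℕ, Chain N l (extendZero κ) mu}
    (h1 : p.1 = q.1) (h2 : p.2.val = q.2.val) : p = q := by
  obtain ⟨κ, c⟩ := p
  obtain ⟨κ', c'⟩ := q
  obtain rfl : κ = κ' := h1
  congr 1
  exact Chain.ext h2

theorem Chain.cast_val {N l : ℕ} {lam lam' mu : ℕ → ℕ} (h : lam = lam') (c : Chain N l lam mu) :
    (h ▸ c : Chain N l lam' mu).val = c.val := by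
  subst h; rfl

/-- A chain is its last horizontal strip `lam / κ`, which carries the power of the last variable,
together with a shorter chain ending at `κ`. -/
theorem chainSum_succ {N l : ℕ} (x : Fin (N + 1) → R) (lam mu : ℕ → ℕ)
    (hl : ∀ i, l ≤ i → lam i = 0) :
    chainSum x l lam mu = ∑ κ ∈ stripsBelow l lam, x (Fin.last N) ^ (∑ i : Fin l, (lam i - κ i)) *
      chainSum (fun a => x a.castSucc) l (extendZero κ) mu := by
  simp only [chainSum, Finset.mul_sum]
  rw [Finset.sum_sigma']
  have hres : ∀ c : Chain (N + 1) l lam mu, c.val N = extendZero fun i : Fin l => c.val N i :=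
    fun c => (extendZero_restrict (c.val N) (c.bdd N)).symm
  have hmem : ∀ p ∈ (stripsBelow l lam).sigma fun κ =>
      (Finset.univ : Finset (Chain N l (extendZero κ) mu)),
      (∀ i, extendZero p.1 i ≤ lam i) ∧ ∀ i, lam (i + 1) ≤ extendZero p.1 i := by
    intro p hp
    have h := Fintype.mem_piFinset.mp (Finset.mem_sigma.mp hp).1
    refine ⟨fun i => ?_, fun i => ?_⟩ <;> by_cases hi : i < l
    · rw [extendZero, dif_pos hi]; exact (Finset.mem_Icc.mp (h ⟨i, hi⟩)).2
    · rw [extendZero, dif_neg hi]; exact Nat.zero_le _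
    · rw [extendZero, dif_pos hi]; exact (Finset.mem_Icc.mp (h ⟨i, hi⟩)).1
    · rw [hl (i + 1) (by omega)]; exact Nat.zero_le _
  refine Finset.sum_bij' (fun c _ => ⟨fun i => c.val N i, hres c ▸ c.init⟩)
    (fun p hp => p.2.snoc hl (hmem p hp).1 (hmem p hp).2) (fun c _ => ?_) (fun _ _ => Finset.mem_univ _)
    (fun c _ => ?_) (fun p hp => ?_) (fun c _ => ?_)
  · refine Finset.mem_sigma.mpr ⟨Fintype.mem_piFinset.mpr fun i => Finset.mem_Icc.mpr ⟨?_, ?_⟩,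
      Finset.mem_univ _⟩
    · rw [← c.last (N + 1) le_rfl]; exact c.strip N i
    · exact c.le_last N i
  · refine Chain.ext ?_
    funext a i
    simp only [Chain.snoc, Chain.cast_val, Chain.init]
    split_ifs with h
    · rw [min_eq_left h]
    · rw [c.last a (by omega)]
  · refine sigma_chain_ext ?_ ?_
    · funext i
      simp only [Chain.snoc, if_pos le_rfl]
      rw [p.2.last N le_rfl, extendZero_of_lt]
    · funext a i
      refine (congrFun (congrFun (Chain.cast_val _ _) a) i).trans ?_
      simp only [Chain.init, Chain.snoc, if_pos (min_le_right a N)]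
      rcases le_total a N with h | h
      · rw [min_eq_left h]
      · rw [min_eq_right h, p.2.last N le_rfl, p.2.last a h]
  · rw [Fin.prod_univ_castSucc, mul_comm]
    congr 1
    · rw [Fin.val_last, Chain.wt, Finset.sum_range]
      simp only [c.last (N + 1) le_rfl]
    · refine Finset.prod_congr rfl fun a _ => ?_
      simp only [Chain.wt, Chain.cast_val, Chain.init, Fin.val_castSucc]
      rw [min_eq_left (by omega), min_eq_left (by omega)]

open Classical in
theorem chainSum_fin_zero {l : ℕ} (x : Fin 0 → R) (lam mu : ℕ → ℕ)
    (hl : ∀ i, l ≤ i → lam i = 0) (hanti : Antitone lam) :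
    chainSum x l lam mu = if lam = mu then 1 else 0 := by
  rw [chainSum]
  simp only [Finset.univ_eq_empty, Finset.prod_empty, Finset.sum_const, nsmul_one]
  split_ifs with h
  · subst h
    have : Fintype.card (Chain 0 l lam lam) = 1 := Fintype.card_eq_one_iff.mpr
      ⟨⟨fun _ => lam, fun _ => rfl, fun _ _ _ => rfl, fun _ _ => le_rfl,
        fun _ i => hanti (Nat.le_succ i), fun _ => hl⟩, fun c => Chain.ext (by
          funext a i; exact c.last a (Nat.zero_le _) i)⟩
    rw [Finset.card_univ, this, Nat.cast_one]
  · have : IsEmpty (Chain 0 l lam mu) :=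
      ⟨fun c => h (funext fun i => by rw [← c.zero, c.last 0 le_rfl])⟩
    simp

/-- The parts of `lam + ρ`, in increasing order. -/
def shifted (l : ℕ) (lam : ℕ → ℕ) (i : Fin l) : ℕ := lam i.rev + i

theorem shifted_strictMono {l : ℕ} {lam : ℕ → ℕ} (h : Antitone lam) : StrictMono (shifted l lam) :=
  fun i j hij => by
    have h1 := h (show (j.rev : ℕ) ≤ i.rev from Fin.rev_le_rev.mpr hij.le)
    have h2 : (i : ℕ) < j := hij
    simp only [shifted]; omega

theorem shifted_injective {l : ℕ} {lam mu : ℕ → ℕ} (hlam : ∀ i, l ≤ i → lam i = 0)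
    (hmu : ∀ i, l ≤ i → mu i = 0) (h : shifted l lam = shifted l mu) : lam = mu := by
  funext i
  by_cases hi : i < l
  · have := congrFun h (Fin.rev ⟨i, hi⟩)
    simpa [shifted] using this
  · rw [hlam i (by omega), hmu i (by omega)]

/-- After adding `ρ` and reversing the order, the strip condition `lam (r + 1) ≤ κ r ≤ lam r`
becomes `v (i - 1) < c i ≤ v i`. This matches the recursion for chains with the one for
determinants. -/
theorem chainSum_strips_eq {l : ℕ} {lam : ℕ → ℕ} (hl : ∀ i, l + 1 ≤ i → lam i = 0)
    (z : R) (F : (Fin (l + 1) → ℕ) → R) :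
    ∑ κ ∈ stripsBelow (l + 1) lam, z ^ (∑ i : Fin (l + 1), (lam i - κ i)) *
      F (shifted (l + 1) (extendZero κ)) =
    ∑ c ∈ Fintype.piFinset (interlacing (shifted (l + 1) lam)),
      z ^ (∑ i, (shifted (l + 1) lam i - c i)) * F c := by
  have key : ∀ i : Fin (l + 1), ∀ c, c ∈ interlacing (shifted (l + 1) lam) i ↔
      lam (i.rev + 1) + i ≤ c ∧ c ≤ lam i.rev + i := by
    intro i c
    induction i using Fin.cases with
    | zero =>
      -- Below the last row the partition is zero, so the smallest exponent is bounded only from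
      -- above.
      have : lam (l + 1) = 0 := hl _ le_rfl
      simp [interlacing, shifted, this]
    | succ i =>
      have e1 : ((i.succ.rev : Fin (l + 1)) : ℕ) + 1 = (i.castSucc.rev : Fin (l + 1)) := by
        simp only [Fin.val_rev, Fin.val_succ, Fin.val_castSucc]; omega
      simp only [interlacing, Fin.cases_succ, Finset.mem_Ioc, shifted, e1, Fin.val_succ,
        Fin.val_castSucc]
      omega
  refine Finset.sum_nbij' (fun κ i => κ i.rev + i) (fun c i => c i.rev - i.rev) ?_ ?_ ?_ ?_ ?_
  · intro κ h
    refine Fintype.mem_piFinset.mpr fun i => (key i _).mpr ?_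
    have := Finset.mem_Icc.mp (Fintype.mem_piFinset.mp h i.rev)
    omega
  · intro c h
    refine Fintype.mem_piFinset.mpr fun i => Finset.mem_Icc.mpr ?_
    have := (key i.rev _).mp (Fintype.mem_piFinset.mp h i.rev)
    rw [Fin.rev_rev] at this
    omega
  · intro κ _
    funext i
    simp
  · intro c h
    funext i
    have := (key i _).mp (Fintype.mem_piFinset.mp h i)
    simp only [Fin.rev_rev]
    omega
  · intro κ h
    congr 1
    · congr 1
      rw [← Equiv.sum_comp Fin.revPerm]
      refine Finset.sum_congr rfl fun i _ => ?_
      simp only [shifted, Fin.revPerm_apply]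
      omega
    · congr 1
      funext i
      simp only [shifted, extendZero_of_lt]

/-- The Jacobi-Trudi identity in finitely many variables. -/
theorem chainSum_eq_det {N l : ℕ} (x : Fin N → R) (lam mu : ℕ → ℕ)
    (hlam : ∀ i, l + 1 ≤ i → lam i = 0) (hanti : Antitone lam)
    (hmu : ∀ i, l + 1 ≤ i → mu i = 0) (hanti' : Antitone mu) :
    chainSum x (l + 1) lam mu = (Matrix.of fun i j =>
      completeHSub x (shifted (l + 1) lam i) (shifted (l + 1) mu j)).det := by
  induction N generalizing lam with
  | zero =>
    classical
    rw [chainSum_fin_zero x lam mu hlam hanti]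
    simp only [completeHSub_fin_zero]
    rw [det_ite_eq (shifted_strictMono hanti) (shifted_strictMono hanti')]
    exact if_congr ⟨fun h => by rw [h], shifted_injective hlam hmu⟩ rfl rfl
  | succ N ih =>
    rw [chainSum_succ x lam mu hlam, det_completeHSub_succ x _ _
      (shifted_strictMono hanti).monotone, ← chainSum_strips_eq hlam (x (Fin.last N)) fun c =>
        (Matrix.of fun i j => completeHSub (fun a => x a.castSucc) (c i)
          (shifted (l + 1) mu j)).det]
    refine Finset.sum_congr rfl fun κ hκ => ?_
    have h := fun i => Finset.mem_Icc.mp (Fintype.mem_piFinset.mp hκ i)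
    rw [ih (fun a => x a.castSucc) _ (fun i hi => extendZero_of_le κ hi)
      (antitone_nat_of_succ_le fun i => ?_)]
    by_cases hi : i + 1 < l + 1
    · rw [extendZero, dif_pos hi, extendZero, dif_pos (by omega)]
      exact (h ⟨i + 1, hi⟩).2.trans (h ⟨i, by omega⟩).1
    · rw [extendZero_of_le κ (by omega)]; exact Nat.zero_le _

/-- Symmetry is invisible on chains, but clear on the determinant, whose entries are symmetric. -/
theorem chainSum_comp_perm {N l : ℕ} (x : Fin N → R) (σ : Equiv.Perm (Fin N)) (lam mu : ℕ → ℕ)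
    (hlam : ∀ i, l + 1 ≤ i → lam i = 0) (hanti : Antitone lam)
    (hmu : ∀ i, l + 1 ≤ i → mu i = 0) (hanti' : Antitone mu) :
    chainSum (x ∘ σ) (l + 1) lam mu = chainSum x (l + 1) lam mu := by
  rw [chainSum_eq_det _ _ _ hlam hanti hmu hanti', chainSum_eq_det _ _ _ hlam hanti hmu hanti']
  simp only [completeHSub, completeH_comp_perm]

end ChainSum


/-! ### Alternants -/

section Alternant

variable {R : Type*} [CommRing R] {N : ℕ}

/-- The alternant `det (x_i ^ v_j)`. -/
def alternant (x : Fin N → R) (v : Fin N → ℕ) : R := (Matrix.of fun i j => x i ^ v j).det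

theorem alternant_comp_perm (x : Fin N → R) (v : Fin N → ℕ) (σ : Equiv.Perm (Fin N)) :
    alternant x (v ∘ σ) = Equiv.Perm.sign σ * alternant x v :=
  Matrix.det_permute' σ (Matrix.of fun i j => x i ^ v j)

/-- The parts of `λ + ρ`. -/
def addRho (v : ℕ → ℕ) (a : Fin N) : ℕ := v a + (N - 1 - a)

/-- Reversing the columns gives the Vandermonde determinant up to sign. -/
theorem alternant_rho_ne_zero [IsDomain R] {x : Fin N → R} (hx : Function.Injective x) :
    alternant x (addRho 0) ≠ 0 := by
  have h : alternant x (addRho 0) = Equiv.Perm.sign (Fin.revPerm (n := N)) *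
      alternant x fun a => a := by
    rw [← alternant_comp_perm]
    congr 1
    funext a
    simp only [addRho, Pi.zero_apply, Function.comp_apply, Fin.revPerm_apply, Fin.val_rev]
    omega
  rw [h]
  refine mul_ne_zero ?_ (Matrix.det_vandermonde_ne_zero_iff.mpr hx)
  rcases Int.units_eq_one_or (Equiv.Perm.sign (Fin.revPerm (n := N))) with h | h <;> simp [h]

/-- By symmetry, the term of `a_ρ` belonging to `σ` may be multiplied by the skew Schur polynomial
in the variables permuted by `σ`. The exponents then add, and summing over `σ` gives one alternant
for each chain. -/
theorem chainSum_mul_alternant {l : ℕ} (x : Fin N → R) (lam mu : ℕ → ℕ)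
    (hlam : ∀ i, l + 1 ≤ i → lam i = 0) (hanti : Antitone lam)
    (hmu : ∀ i, l + 1 ≤ i → mu i = 0) (hanti' : Antitone mu) :
    chainSum x (l + 1) lam mu * alternant x (addRho 0) =
      ∑ c : Chain N (l + 1) lam mu, alternant x (addRho c.wt) := by
  simp only [alternant, Matrix.det_apply, Matrix.of_apply]
  rw [Finset.sum_comm, Finset.mul_sum]
  refine Finset.sum_congr rfl fun σ _ => ?_
  rw [← Finset.smul_sum, mul_smul_comm, ← chainSum_comp_perm x σ lam mu hlam hanti hmu hanti',
    chainSum, Finset.sum_mul]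
  congr 1
  refine Finset.sum_congr rfl fun c _ => ?_
  rw [← Finset.prod_mul_distrib]
  refine Finset.prod_congr rfl fun a _ => ?_
  rw [Function.comp_apply, ← pow_add, addRho, addRho, Pi.zero_apply, zero_add]

end Alternant

/-! ### The sign-reversing involution -/

theorem sum_max_add_sum_min (s : Finset ℕ) (f : ℕ → ℕ) (j : ℕ) :
    ∑ i ∈ s, max (f i) j + ∑ i ∈ s, min (f i) j = ∑ i ∈ s, f i + ∑ _i ∈ s, j := by
  rw [← Finset.sum_add_distrib, ← Finset.sum_add_distrib]
  exact Finset.sum_congr rfl fun i _ => max_add_min _ _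

/-- The bounds of the interval in which a middle term of a chain may move, summed over rows. -/
theorem sum_toggle_bounds (A B : ℕ → ℕ) (l : ℕ) :
    ∑ i ∈ Finset.range (l + 1), (max (B i) (A (i + 1)) +
      (if i = 0 then A i else min (A i) (B (i - 1)))) + B l =
    ∑ i ∈ Finset.range (l + 1), (A i + B i) + max (B l) (A (l + 1)) := by
  induction l with
  | zero => simp; omega
  | succ l ih =>
    rw [Finset.sum_range_succ, Finset.sum_range_succ _ (l + 1), if_neg (by omega),
      Nat.add_sub_cancel]
    omega

namespace Chain

variable {N l : ℕ} {lam mu : ℕ → ℕ}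

theorem wt_add_sum (c : Chain N l lam mu) (a : ℕ) :
    c.wt a + ∑ i ∈ Finset.range l, c.val a i = ∑ i ∈ Finset.range l, c.val (a + 1) i := by
  rw [wt, ← Finset.sum_add_distrib]
  exact Finset.sum_congr rfl fun i _ => Nat.sub_add_cancel (c.mono a i)

/-- The number of letters `a` in the columns from `j` on. -/
def colWt (c : Chain N l lam mu) (a j : ℕ) : ℕ :=
  ∑ i ∈ Finset.range l, (max (c.val (a + 1) i) j - max (c.val a i) j)

theorem colWt_add_sum (c : Chain N l lam mu) (a j : ℕ) :
    c.colWt a j + ∑ i ∈ Finset.range l, max (c.val a i) j =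
      ∑ i ∈ Finset.range l, max (c.val (a + 1) i) j := by
  rw [colWt, ← Finset.sum_add_distrib]
  exact Finset.sum_congr rfl fun i _ => Nat.sub_add_cancel (max_le_max (c.mono a i) le_rfl)

theorem colWt_of_le (c : Chain N l lam mu) {a : ℕ} (h : N ≤ a) (j : ℕ) : c.colWt a j = 0 :=
  Finset.sum_eq_zero fun i _ => by rw [c.last a h, c.last (a + 1) (by omega), Nat.sub_self]

/-- The number of letters `a` in column `j`. -/
def inCol (c : Chain N l lam mu) (a j : ℕ) : ℕ :=
  ((Finset.range l).filter fun i => c.val a i ≤ j ∧ j < c.val (a + 1) i).card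

/-- A horizontal strip has at most one cell in each column. -/
theorem inCol_le_one (c : Chain N l lam mu) (a j : ℕ) : c.inCol a j ≤ 1 := by
  have key : ∀ i i', c.val a i ≤ j → j < c.val (a + 1) i' → i' ≤ i := fun i i' h1 h2 => by
    by_contra! h
    have := c.anti (a + 1) (show i + 1 ≤ i' from h)
    have := c.strip a i
    omega
  refine Finset.card_le_one.mpr fun i hi i' hi' => ?_
  obtain ⟨-, h1, h2⟩ := Finset.mem_filter.mp hi
  obtain ⟨-, h3, h4⟩ := Finset.mem_filter.mp hi'
  exact le_antisymm (key _ _ h3 h2) (key _ _ h1 h4)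

theorem colWt_eq_add_inCol (c : Chain N l lam mu) (a j : ℕ) :
    c.colWt a j = c.colWt a (j + 1) + c.inCol a j := by
  rw [colWt, colWt, inCol, Finset.card_filter, ← Finset.sum_add_distrib]
  refine Finset.sum_congr rfl fun i _ => ?_
  have := c.mono a i
  split_ifs <;> omega

/-- The chain is good if, from any column on, the numbers of letters `0, 1, 2, …` decrease. -/
def IsGood (c : Chain N l lam mu) : Prop := ∀ j a, c.colWt (a + 1) j ≤ c.colWt a j

/-- `j` is the last column where goodness fails, and `k` the least letter for which it does. -/
structure IsFirstBad (c : Chain N l lam mu) (j k : ℕ) : Prop where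
  lt : c.colWt k j < c.colWt (k + 1) j
  least : ∀ a < k, c.colWt (a + 1) j ≤ c.colWt a j
  last : ∀ j', j < j' → ∀ a, c.colWt (a + 1) j' ≤ c.colWt a j'

theorem colWt_of_col_le (c : Chain N l lam mu) (a : ℕ) {j : ℕ} (h : lam 0 ≤ j) : c.colWt a j = 0 :=
  Finset.sum_eq_zero fun i _ => by
    have h1 : ∀ b, c.val b i ≤ j := fun b =>
      ((c.anti b (Nat.zero_le i)).trans (c.le_last b 0)).trans h
    rw [max_eq_right (h1 _), max_eq_right (h1 _), Nat.sub_self]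

/-- Columns from `lam 0` on are empty and cannot be bad, so a last bad column exists. -/
theorem exists_isFirstBad {c : Chain N l lam mu} (h : ¬ c.IsGood) : ∃ j k, c.IsFirstBad j k := by
  classical
  rw [IsGood] at h
  push Not at h
  obtain ⟨j0, hj0⟩ := h
  have hb : j0 ≤ lam 0 := by
    by_contra! hlt
    obtain ⟨a, ha⟩ := hj0
    rw [c.colWt_of_col_le _ hlt.le, c.colWt_of_col_le _ hlt.le] at ha
    exact lt_irrefl _ ha
  set P : ℕ → Prop := fun j => ∃ a, c.colWt a j < c.colWt (a + 1) j
  have hP : P (Nat.findGreatest P (lam 0)) := Nat.findGreatest_spec hb hj0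
  refine ⟨Nat.findGreatest P (lam 0), Nat.find hP, Nat.find_spec hP,
    fun a ha => not_lt.mp (Nat.find_min hP ha), fun j' hj' a => ?_⟩
  by_contra! hlt
  rcases le_or_gt j' (lam 0) with h | h
  · exact Nat.findGreatest_is_greatest hj' h ⟨a, hlt⟩
  · rw [c.colWt_of_col_le _ h.le, c.colWt_of_col_le _ h.le] at hlt
    exact lt_irrefl _ hlt

theorem IsFirstBad.unique {c : Chain N l lam mu} {j k j' k' : ℕ} (h : c.IsFirstBad j k)
    (h' : c.IsFirstBad j' k') : j = j' ∧ k = k' := by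
  have hj : j = j' := by
    rcases lt_trichotomy j j' with hlt | rfl | hlt
    · exact absurd h'.lt (not_lt.mpr (h.last _ hlt _))
    · rfl
    · exact absurd h.lt (not_lt.mpr (h'.last _ hlt _))
  subst hj
  refine ⟨rfl, ?_⟩
  rcases lt_trichotomy k k' with hlt | rfl | hlt
  · exact absurd h.lt (not_lt.mpr (h'.least _ hlt))
  · rfl
  · exact absurd h'.lt (not_lt.mpr (h.least _ hlt))

/-- Goodness holds from column `j + 1` on and a column contains each letter at most once. It can
therefore fail at `j` only by exactly one, with a `k + 1` and no `k` in column `j`. -/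
theorem IsFirstBad.colWt_eq {c : Chain N l lam mu} {j k : ℕ} (h : c.IsFirstBad j k) :
    c.colWt (k + 1) j = c.colWt k j + 1 ∧ c.inCol k j = 0 := by
  have h1 := h.lt
  have h2 := h.last (j + 1) (Nat.lt_succ_self j) k
  have h3 := c.colWt_eq_add_inCol k j
  have h4 := c.colWt_eq_add_inCol (k + 1) j
  have h5 := c.inCol_le_one (k + 1) j
  omega

/-- Column `j` has no letter `k`, so no strip of letters `k` crosses it. This is why the columns
before `j` can be changed independently of the rest. -/
theorem IsFirstBad.lt_val {c : Chain N l lam mu} {j k : ℕ} (h : c.IsFirstBad j k) {i : ℕ}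
    (hi : j < c.val (k + 1) i) : j < c.val k i := by
  by_contra! hle
  have hil : i < l := by
    by_contra! hil
    rw [c.bdd _ i hil] at hi
    omega
  have := Finset.card_eq_zero.mp h.colWt_eq.2
  exact Finset.notMem_empty i (this ▸ Finset.mem_filter.mpr ⟨Finset.mem_range.mpr hil, hle, hi⟩)

theorem IsFirstBad.succ_lt {c : Chain N l lam mu} {j k : ℕ} (h : c.IsFirstBad j k) : k + 1 < N := by
  by_contra! hN
  have := h.lt
  rw [c.colWt_of_le hN] at this
  omega

/-- The Bender-Knuth involution for the letters `k` and `k + 1`, applied to the columns before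
`j`. -/
def toggleVal (v : ℕ → ℕ → ℕ) (j k a i : ℕ) : ℕ :=
  if a = k + 1 ∧ v (k + 1) i ≤ j then
    max (v k i) (v (k + 1 + 1) (i + 1)) +
      (if i = 0 then min j (v (k + 1 + 1) i) else min (min j (v (k + 1 + 1) i)) (v k (i - 1))) -
      v (k + 1) i
  else v a i

/-- The boundary between the letters `k` and `k + 1` is reflected in the interval in which it may
move: above the inner boundary and the next row of the outer one, below `j`, the outer boundary and
the previous row of the inner one. The top row has no previous row, hence the case split. -/
theorem toggleVal_of_le {v : ℕ → ℕ → ℕ} {j k i : ℕ} (h : v (k + 1) i ≤ j) :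
    toggleVal v j k (k + 1) i = max (v k i) (v (k + 1 + 1) (i + 1)) +
      (if i = 0 then min j (v (k + 1 + 1) i) else min (min j (v (k + 1 + 1) i)) (v k (i - 1))) -
      v (k + 1) i := if_pos ⟨rfl, h⟩

theorem toggleVal_of_ne (v : ℕ → ℕ → ℕ) (j k : ℕ) {a : ℕ} (h : a ≠ k + 1) (i : ℕ) :
    toggleVal v j k a i = v a i := if_neg fun h' => h h'.1

theorem toggleVal_of_lt (v : ℕ → ℕ → ℕ) {j k i : ℕ} (h : j < v (k + 1) i) :
    toggleVal v j k (k + 1) i = v (k + 1) i := if_neg fun h' => absurd h'.2 (not_le.mpr h)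

/-- The range in which the toggled entry lies. -/
theorem toggleVal_bounds (c : Chain N l lam mu) {j k i : ℕ} (h : c.val (k + 1) i ≤ j) :
    c.val k i ≤ toggleVal c.val j k (k + 1) i ∧
    c.val (k + 1 + 1) (i + 1) ≤ toggleVal c.val j k (k + 1) i ∧
    toggleVal c.val j k (k + 1) i ≤ j ∧ toggleVal c.val j k (k + 1) i ≤ c.val (k + 1 + 1) i ∧
    (i ≠ 0 → toggleVal c.val j k (k + 1) i ≤ c.val k (i - 1)) := by
  have h1 := c.mono k i
  have h2 := c.mono (k + 1) i
  have h3 := c.strip (k + 1) i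
  rw [toggleVal_of_le h]
  cases i with
  | zero => simp only [if_pos]; omega
  | succ i =>
    have h4 := c.strip k i
    rw [if_neg (by omega), Nat.add_sub_cancel]
    omega

/-- The involution on chains that are not good. -/
def toggle (c : Chain N l lam mu) {j k : ℕ} (h : c.IsFirstBad j k) : Chain N l lam mu where
  val := toggleVal c.val j k
  zero i := by rw [toggleVal_of_ne _ _ _ (by omega), c.zero]
  last a ha i := by
    have := h.succ_lt
    rw [toggleVal_of_ne _ _ _ (by omega), c.last a ha]
  mono a i := by
    by_cases ha : a = k
    · subst ha
      rw [toggleVal_of_ne _ _ _ (by omega)]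
      rcases le_or_gt (c.val (a + 1) i) j with hi | hi
      · exact (toggleVal_bounds c hi).1
      · rw [toggleVal_of_lt _ hi]; exact c.mono a i
    · by_cases ha' : a = k + 1
      · subst ha'
        rw [toggleVal_of_ne _ _ _ (show k + 1 + 1 ≠ k + 1 by omega)]
        rcases le_or_gt (c.val (k + 1) i) j with hi | hi
        · exact (toggleVal_bounds c hi).2.2.2.1
        · rw [toggleVal_of_lt _ hi]; exact c.mono (k + 1) i
      · rw [toggleVal_of_ne _ _ _ ha', toggleVal_of_ne _ _ _ (by omega)]
        exact c.mono a i
  strip a i := by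
    by_cases ha : a = k
    · subst ha
      rw [toggleVal_of_ne _ _ _ (show a ≠ a + 1 by omega)]
      rcases le_or_gt (c.val (a + 1) (i + 1)) j with hi | hi
      · exact (toggleVal_bounds c hi).2.2.2.2 (by omega)
      · rw [toggleVal_of_lt _ hi]; exact c.strip a i
    · by_cases ha' : a = k + 1
      · subst ha'
        rw [toggleVal_of_ne _ _ _ (show k + 1 + 1 ≠ k + 1 by omega)]
        rcases le_or_gt (c.val (k + 1) i) j with hi | hi
        · exact (toggleVal_bounds c hi).2.1
        · rw [toggleVal_of_lt _ hi]; exact c.strip (k + 1) i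
      · rw [toggleVal_of_ne _ _ _ ha', toggleVal_of_ne _ _ _ (by omega)]
        exact c.strip a i
  bdd a i hi := by
    by_cases ha : a = k + 1
    · subst ha
      have h0 := (toggleVal_bounds c (j := j) (k := k) (i := i)
        (by rw [c.bdd _ i hi]; exact Nat.zero_le _)).2.2.2.1
      rw [c.bdd _ i hi] at h0
      omega
    · rw [toggleVal_of_ne _ _ _ ha, c.bdd a i hi]

theorem toggle_max {c : Chain N l lam mu} {j k : ℕ} (h : c.IsFirstBad j k) {j' : ℕ} (hj : j ≤ j')
    (a i : ℕ) : max ((c.toggle h).val a i) j' = max (c.val a i) j' := by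
  change max (toggleVal c.val j k a i) j' = _
  by_cases ha : a = k + 1
  · subst ha
    rcases le_or_gt (c.val (k + 1) i) j with hi | hi
    · have := (toggleVal_bounds c hi).2.2.1
      omega
    · rw [toggleVal_of_lt _ hi]
  · rw [toggleVal_of_ne _ _ _ ha]

theorem toggle_colWt {c : Chain N l lam mu} {j k : ℕ} (h : c.IsFirstBad j k) {j' : ℕ} (hj : j ≤ j')
    (a : ℕ) : (c.toggle h).colWt a j' = c.colWt a j' := by
  simp only [colWt, toggle_max h hj]

/-- Being the first bad position depends only on the columns from `j` on, which the toggle leaves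
alone. -/
theorem toggle_isFirstBad {c : Chain N l lam mu} {j k : ℕ} (h : c.IsFirstBad j k) :
    (c.toggle h).IsFirstBad j k where
  lt := by rw [toggle_colWt h le_rfl, toggle_colWt h le_rfl]; exact h.lt
  least a ha := by rw [toggle_colWt h le_rfl, toggle_colWt h le_rfl]; exact h.least a ha
  last j' hj a := by rw [toggle_colWt h hj.le, toggle_colWt h hj.le]; exact h.last j' hj a

/-- The interval of reflection depends only on neighbouring boundaries that do not move, so
reflecting twice is the identity. -/
theorem toggle_toggle {c : Chain N l lam mu} {j k j' k' : ℕ} (h : c.IsFirstBad j k)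
    (h' : (c.toggle h).IsFirstBad j' k') : (c.toggle h).toggle h' = c := by
  obtain ⟨rfl, rfl⟩ := (toggle_isFirstBad h).unique h'
  refine Chain.ext ?_
  funext a i
  change toggleVal (toggleVal c.val j k) j k a i = _
  by_cases ha : a = k + 1
  · subst ha
    rcases le_or_gt (c.val (k + 1) i) j with hi | hi
    · have hb := (toggleVal_bounds c hi).2.2.1
      rw [toggleVal_of_le hb]
      simp only [toggleVal_of_ne c.val j k (show k ≠ k + 1 by omega),
        toggleVal_of_ne c.val j k (show k + 1 + 1 ≠ k + 1 by omega)]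
      rw [toggleVal_of_le hi]
      have h1 := c.mono k i
      have h2 := c.mono (k + 1) i
      have h3 := c.strip (k + 1) i
      cases i with
      | zero => simp only [if_pos]; omega
      | succ i =>
        have h4 := c.strip k i
        rw [if_neg (by omega), Nat.add_sub_cancel]
        omega
    · have : toggleVal c.val j k (k + 1) i = c.val (k + 1) i := toggleVal_of_lt _ hi
      rw [toggleVal_of_lt _ (by rw [this]; exact hi), this]
  · rw [toggleVal_of_ne _ _ _ ha, toggleVal_of_ne _ _ _ ha]

/-- In columns before `j`, the old and new middle boundaries add up to the two ends of the interval.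
Summed over the rows, these ends recombine into the inner and outer boundaries, because `max` of a
pair plus `min` of the same pair is its sum. -/
theorem toggle_sum_min {c : Chain N l lam mu} {j k : ℕ} (h : c.IsFirstBad j k) :
    ∑ i ∈ Finset.range l, min ((c.toggle h).val (k + 1) i) j +
      ∑ i ∈ Finset.range l, min (c.val (k + 1) i) j =
    ∑ i ∈ Finset.range l, min (c.val k i) j + ∑ i ∈ Finset.range l, min (c.val (k + 1 + 1) i) j := by
  obtain _ | l := l
  · simp
  have key := sum_toggle_bounds (fun i => min (c.val (k + 1 + 1) i) j) (fun i => min (c.val k i) j) l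
  simp only [c.bdd (k + 1 + 1) (l + 1) le_rfl, Nat.zero_min, Nat.max_zero, Nat.add_right_cancel_iff]
    at key
  rw [← Finset.sum_add_distrib, ← Finset.sum_add_distrib,
    Finset.sum_congr rfl fun i _ => add_comm (min (c.val k i) j) _, ← key]
  refine Finset.sum_congr rfl fun i _ => ?_
  change min (toggleVal c.val j k (k + 1) i) j + _ = _
  have h1 := c.mono k i
  have h2 := c.mono (k + 1) i
  have h3 := c.strip (k + 1) i
  rcases le_or_gt (c.val (k + 1) i) j with hi | hi
  · have hb := (toggleVal_bounds c hi).2.2.1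
    rw [min_eq_left hb, toggleVal_of_le hi]
    cases i with
    | zero => simp only [if_pos]; omega
    | succ i =>
      have h4 := c.strip k i
      rw [if_neg (by omega), if_neg (by omega), Nat.add_sub_cancel]
      omega
  -- In such a row the boundary does not move, and all quantities truncated at `j` equal `j`.
  · have := h.lt_val hi
    rw [toggleVal_of_lt _ hi]
    cases i with
    | zero => simp only [if_pos]; omega
    | succ i =>
      have h4 := c.strip k i
      rw [if_neg (by omega), Nat.add_sub_cancel]
      omega

/-- Before column `j` the numbers of letters `k` and `k + 1` are interchanged; from `j` on they are
unchanged and differ by one. That one is exactly the difference of consecutive entries of `ρ`. -/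
theorem toggle_wt {c : Chain N l lam mu} {j k : ℕ} (h : c.IsFirstBad j k) :
    (c.toggle h).wt k + 1 = c.wt (k + 1) ∧ (c.toggle h).wt (k + 1) = c.wt k + 1 := by
  have e0 : ∀ i, (c.toggle h).val k i = c.val k i := fun i =>
    toggleVal_of_ne _ _ _ (by omega) i
  have e2 : ∀ i, (c.toggle h).val (k + 1 + 1) i = c.val (k + 1 + 1) i := fun i =>
    toggleVal_of_ne _ _ _ (by omega) i
  have h1 := (c.toggle h).wt_add_sum k
  have h2 := (c.toggle h).wt_add_sum (k + 1)
  have h3 := c.wt_add_sum k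
  have h4 := c.wt_add_sum (k + 1)
  have h5 := c.colWt_add_sum k j
  have h6 := c.colWt_add_sum (k + 1) j
  have h7 := toggle_sum_min h
  have h8 := sum_max_add_sum_min (Finset.range l) ((c.toggle h).val (k + 1)) j
  have h9 := sum_max_add_sum_min (Finset.range l) (c.val (k + 1)) j
  have h10 := sum_max_add_sum_min (Finset.range l) (c.val k) j
  have h11 := sum_max_add_sum_min (Finset.range l) (c.val (k + 1 + 1)) j
  have h12 := h.colWt_eq.1
  simp only [toggle_max h le_rfl] at h8
  simp only [e0, e2] at h1 h2
  omega

theorem toggle_wt_of_ne {c : Chain N l lam mu} {j k : ℕ} (h : c.IsFirstBad j k) {a : ℕ}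
    (h1 : a ≠ k) (h2 : a ≠ k + 1) : (c.toggle h).wt a = c.wt a := by
  refine Finset.sum_congr rfl fun i _ => ?_
  change toggleVal c.val j k (a + 1) i - toggleVal c.val j k a i = _
  rw [toggleVal_of_ne _ _ _ (by omega), toggleVal_of_ne _ _ _ h2]

/-- With `ρ` added, the change of weight is a transposition of two exponents. -/
theorem alternant_toggle {R : Type*} [CommRing R] (x : Fin N → R) {c : Chain N l lam mu} {j k : ℕ}
    (h : c.IsFirstBad j k) :
    alternant x (addRho (c.toggle h).wt) = -alternant x (addRho c.wt) := by
  have hk := h.succ_lt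
  have hw := toggle_wt h
  have e : (addRho (c.toggle h).wt : Fin N → ℕ) = addRho c.wt ∘
      Equiv.swap (⟨k, by omega⟩ : Fin N) ⟨k + 1, hk⟩ := by
    funext a
    rw [Function.comp_apply, addRho, addRho]
    by_cases h1 : a = ⟨k, by omega⟩
    · subst h1
      rw [Equiv.swap_apply_left]
      simp only
      omega
    · by_cases h2 : a = ⟨k + 1, hk⟩
      · subst h2
        rw [Equiv.swap_apply_right]
        simp only
        omega
      · rw [Equiv.swap_apply_of_ne_of_ne h1 h2, toggle_wt_of_ne h (fun h' => h1 (Fin.ext h'))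
          fun h' => h2 (Fin.ext h')]
  rw [e, alternant_comp_perm, Equiv.Perm.sign_swap (by simp)]
  simp

end Chain

open Classical in
theorem sum_alternant_eq_sum_good {R : Type*} [CommRing R] [CharZero R] [NoZeroDivisors R]
    {N l : ℕ} {lam mu : ℕ → ℕ} (x : Fin N → R) :
    ∑ c : Chain N l lam mu, alternant x (addRho c.wt) =
      ∑ c : Chain N l lam mu with c.IsGood, alternant x (addRho c.wt) := by
  rw [← Finset.sum_filter_add_sum_filter_not Finset.univ Chain.IsGood, add_eq_left]
  have hbad : ∀ c : Chain N l lam mu, ∃ p : ℕ × ℕ, ¬ c.IsGood → c.IsFirstBad p.1 p.2 := fun c => by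
    by_cases h : c.IsGood
    · exact ⟨0, fun h' => absurd h h'⟩
    · obtain ⟨j, k, h⟩ := Chain.exists_isFirstBad h
      exact ⟨(j, k), fun _ => h⟩
  choose p hp using hbad
  replace hp : ∀ c ∈ Finset.univ.filter fun c : Chain N l lam mu => ¬ c.IsGood,
      c.IsFirstBad (p c).1 (p c).2 := fun c hc => hp c (Finset.mem_filter.mp hc).2
  refine Finset.sum_involution (fun c hc => c.toggle (hp c hc)) (fun c hc => ?_)
    (fun c hc h0 heq => ?_) (fun c hc => ?_) fun c hc => Chain.toggle_toggle _ _
  · rw [Chain.alternant_toggle, add_neg_cancel]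
  -- At a fixed chain the alternant is its own negative, hence zero in characteristic zero.
  · have h := Chain.alternant_toggle x (hp c hc)
    rw [heq] at h
    exact h0 (self_eq_neg.mp h)
  · refine Finset.mem_filter.mpr ⟨Finset.mem_univ _, fun hg => ?_⟩
    exact absurd (Chain.toggle_isFirstBad (hp c hc)).lt (not_lt.mpr (hg _ _))


/-! ### Ballot chains -/

namespace Chain

variable {N l : ℕ} {lam mu : ℕ → ℕ}

/-- The ballot condition read row by row: up to any row, there are at most as many letters `a + 1`
as there are letters `a` in the rows strictly before. -/
def IsRowBallot (c : Chain N l lam mu) : Prop := ∀ a i,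
  ∑ r ∈ Finset.range (i + 1), (c.val (a + 2) r - c.val (a + 1) r) ≤
    ∑ r ∈ Finset.range i, (c.val (a + 1) r - c.val a r)

/-- If row `i` contains the letter `a + 1`, cut at the column of its leftmost occurrence there. All
letters `a + 1` in rows up to `i` lie in or to the right of that column, and all letters `a` there
lie in rows before `i`. If row `i` has no `a + 1`, pass to the previous row. -/
theorem IsGood.isRowBallot {c : Chain N l lam mu} (h : c.IsGood) : c.IsRowBallot := by
  intro a i
  rcases (c.mono (a + 1) i).lt_or_eq with hlt | heq
  · have hil : i < l := by
      by_contra! hil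
      rw [c.bdd _ i hil, c.bdd _ i hil] at hlt
      exact lt_irrefl _ hlt
    have h1 : ∑ r ∈ Finset.range (i + 1), (c.val (a + 2) r - c.val (a + 1) r) ≤
        c.colWt (a + 1) (c.val (a + 1) i) := by
      refine le_trans (Finset.sum_le_sum fun r hr => ?_) (Finset.sum_le_sum_of_subset
        (Finset.range_subset_range.mpr (show i + 1 ≤ l from hil)))
      have := c.anti (a + 1) (show r ≤ i by have := Finset.mem_range.mp hr; omega)
      have := c.mono (a + 1) r
      change c.val (a + 1 + 1) r - _ ≤ _
      omega
    have h2 : c.colWt a (c.val (a + 1) i) ≤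
        ∑ r ∈ Finset.range i, (c.val (a + 1) r - c.val a r) := by
      rw [colWt, ← Finset.sum_subset (Finset.range_subset_range.mpr hil.le) fun r _ hr => ?_]
      · exact Finset.sum_le_sum fun r _ => by omega
      · have := c.anti (a + 1) (show i ≤ r by have := Finset.mem_range.not.mp hr; omega)
        omega
    exact h1.trans ((h _ a).trans h2)
  · rw [Finset.sum_range_succ, heq, Nat.sub_self, add_zero]
    cases i with
    | zero => simp
    | succ i =>
      exact (h.isRowBallot a i).trans
        (Finset.sum_le_sum_of_subset (Finset.range_subset_range.mpr (Nat.le_succ i)))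

/-- Cut at the first row whose letters at most `a + 1` all lie in columns before `j`: letters `a +
1` from column `j` on occur strictly above it. The row inequality there is corrected by the letters
in columns before `j`. -/
theorem IsRowBallot.isGood {c : Chain N l lam mu} (h : c.IsRowBallot) : c.IsGood := by
  intro j a
  have hex : ∃ m, c.val (a + 2) m ≤ j := ⟨l, by rw [c.bdd _ l le_rfl]; exact Nat.zero_le _⟩
  obtain ⟨i, hi, hlt⟩ : ∃ i, c.val (a + 2) i ≤ j ∧ ∀ r < i, j < c.val (a + 2) r := by
    classical
    exact ⟨Nat.find hex, Nat.find_spec hex, fun r hr => not_le.mp (Nat.find_min hex hr)⟩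
  have hil : i ≤ l := by
    by_contra! hil
    have := hlt l hil
    rw [c.bdd _ l le_rfl] at this
    omega
  have h1 : c.colWt (a + 1) j =
      ∑ r ∈ Finset.range i, (max (c.val (a + 2) r) j - max (c.val (a + 1) r) j) := by
    rw [colWt, ← Finset.sum_subset (Finset.range_subset_range.mpr hil) fun r _ hr => ?_]
    have := c.anti (a + 2) (show i ≤ r by have := Finset.mem_range.not.mp hr; omega)
    change max (c.val (a + 2) r) j - _ = 0
    omega
  rw [h1]
  cases i with
  | zero => simp
  | succ i =>
    have h2 : ∑ r ∈ Finset.range i, (max (c.val (a + 1) r) j - max (c.val a r) j) ≤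
        c.colWt a j := Finset.sum_le_sum_of_subset (Finset.range_subset_range.mpr (by omega))
    refine le_trans ?_ h2
    have e1 : ∑ r ∈ Finset.range (i + 1), (c.val (a + 2) r - c.val (a + 1) r) =
        ∑ r ∈ Finset.range (i + 1), (max (c.val (a + 2) r) j - max (c.val (a + 1) r) j) +
        ∑ r ∈ Finset.range (i + 1), (min (c.val (a + 2) r) j - min (c.val (a + 1) r) j) := by
      rw [← Finset.sum_add_distrib]
      refine Finset.sum_congr rfl fun r _ => ?_
      have : c.val (a + 1) r ≤ c.val (a + 2) r := c.mono (a + 1) r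
      omega
    have e2 : ∑ r ∈ Finset.range i, (c.val (a + 1) r - c.val a r) =
        ∑ r ∈ Finset.range i, (max (c.val (a + 1) r) j - max (c.val a r) j) +
        ∑ r ∈ Finset.range i, (min (c.val (a + 1) r) j - min (c.val a r) j) := by
      rw [← Finset.sum_add_distrib]
      refine Finset.sum_congr rfl fun r _ => ?_
      have := c.mono a r
      omega
    -- Each of these rows is followed by one whose letters `a + 1` extend past column `j`; hence
    -- every `a` in a column before `j` has an `a + 1` directly below it.
    have e3 : ∑ r ∈ Finset.range i, (min (c.val (a + 1) r) j - min (c.val a r) j) ≤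
        ∑ r ∈ Finset.range (i + 1), (min (c.val (a + 2) r) j - min (c.val (a + 1) r) j) := by
      rw [Finset.sum_range_succ']
      refine le_trans (Finset.sum_le_sum fun r hr => ?_) (Nat.le_add_right _ _)
      have h3 := hlt (r + 1) (by have := Finset.mem_range.mp hr; omega)
      have h4 := c.strip a r
      omega
    have h5 := h a i
    omega

theorem isRowBallot_iff_isGood {c : Chain N l lam mu} : c.IsRowBallot ↔ c.IsGood :=
  ⟨IsRowBallot.isGood, IsGood.isRowBallot⟩

/-- Column strictness in a straight shape: entries of row `i` are at least `i`. -/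
theorem val_eq_zero_of_le (c : Chain N l lam 0) {a i : ℕ} (h : a ≤ i) : c.val a i = 0 := by
  induction a generalizing i with
  | zero => exact c.zero i
  | succ a ih =>
    obtain ⟨i, rfl⟩ : ∃ i', i = i' + 1 := ⟨i - 1, by omega⟩
    have h1 := c.strip a i
    rw [ih (by omega)] at h1
    omega

/-- The ballot condition gives the opposite bound, that entries of row `i` are at most `i`: a letter
`b + 1` in row `i ≤ b` needs a letter `b` in an earlier row, where by induction there is none. -/
theorem IsRowBallot.val_succ_eq {c : Chain N l lam 0} (h : c.IsRowBallot) {a i : ℕ} (hi : i < a) :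
    c.val (a + 1) i = c.val a i := by
  induction i using Nat.strong_induction_on generalizing a with
  | _ i ih =>
    obtain ⟨b, rfl⟩ : ∃ b, a = b + 1 := ⟨a - 1, by omega⟩
    have h1 := h b i
    rw [Finset.sum_eq_zero (s := Finset.range i) fun r hr => by
      have hr := Finset.mem_range.mp hr
      rw [ih r hr (by omega), Nat.sub_self]] at h1
    have h2 := Finset.sum_eq_zero_iff.mp (Nat.le_zero.mp h1) i (by simp)
    exact le_antisymm (Nat.sub_eq_zero_iff_le.mp h2) (c.mono (b + 1) i)

theorem IsRowBallot.val_eq {c : Chain N l lam 0} (h : c.IsRowBallot) (a i : ℕ) :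
    c.val a i = if i < a then lam i else 0 := by
  split_ifs with hi
  · have : ∀ m, c.val (a + m) i = c.val a i := fun m => by
      induction m with
      | zero => rfl
      | succ m ih => rw [← add_assoc, h.val_succ_eq (by omega), ih]
    rw [← this N, c.last _ (by omega)]
  · exact c.val_eq_zero_of_le (by omega)

/-- The chain of the tableau all of whose entries in row `i` are `i`. -/
def superstandard (hl : ∀ i, l ≤ i → lam i = 0) (hN : ∀ i, N ≤ i → lam i = 0)
    (hanti : Antitone lam) : Chain N l lam 0 where
  val a i := if i < a then lam i else 0
  zero i := by simp
  last a ha i := by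
    split_ifs with h
    · rfl
    · rw [hN i (by omega)]
  mono a i := by split_ifs <;> omega
  strip a i := by
    have := hanti (Nat.le_succ i)
    split_ifs <;> omega
  bdd a i h := by rw [hl i h, ite_self]

theorem superstandard_step (a r : ℕ) :
    (if r < a + 1 then lam r else 0) - (if r < a then lam r else 0) =
      if r = a then lam r else 0 := by
  split_ifs <;> omega

theorem superstandard_isRowBallot (hl : ∀ i, l ≤ i → lam i = 0) (hN : ∀ i, N ≤ i → lam i = 0)
    (hanti : Antitone lam) : (superstandard hl hN hanti).IsRowBallot := by
  intro a i
  simp only [superstandard]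
  simp only [superstandard_step, Finset.sum_ite_eq', Finset.mem_range]
  have := hanti (Nat.le_succ a)
  split_ifs <;> omega

theorem superstandard_wt (hl : ∀ i, l ≤ i → lam i = 0) (hN : ∀ i, N ≤ i → lam i = 0)
    (hanti : Antitone lam) : (superstandard hl hN hanti).wt = lam := by
  funext a
  simp only [wt, superstandard, superstandard_step, Finset.sum_ite_eq', Finset.mem_range]
  split_ifs with h
  · rfl
  · rw [hl a (by omega)]

end Chain

/-! ### Ballot expansion of skew Schur polynomials and the bialternant formula. -/

section

variable {R : Type*} [CommRing R] [CharZero R] [NoZeroDivisors R] {N l : ℕ} {lam mu : ℕ → ℕ}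

open Classical in
theorem chainSum_mul_alternant_eq_sum_ballot (x : Fin N → R)
    (hlam : ∀ i, l + 1 ≤ i → lam i = 0) (hanti : Antitone lam)
    (hmu : ∀ i, l + 1 ≤ i → mu i = 0) (hanti' : Antitone mu) :
    chainSum x (l + 1) lam mu * alternant x (addRho 0) =
      ∑ c : Chain N (l + 1) lam mu with c.IsRowBallot, alternant x (addRho c.wt) := by
  rw [chainSum_mul_alternant x lam mu hlam hanti hmu hanti', sum_alternant_eq_sum_good]
  simp only [Chain.isRowBallot_iff_isGood]

/-- The bialternant formula. -/
theorem chainSum_straight_mul_alternant (x : Fin N → R) (hlam : ∀ i, l + 1 ≤ i → lam i = 0)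
    (hN : ∀ i, N ≤ i → lam i = 0) (hanti : Antitone lam) :
    chainSum x (l + 1) lam 0 * alternant x (addRho 0) = alternant x (addRho lam) := by
  classical
  -- The superstandard chain is the only ballot chain of straight shape, and its weight is `lam`.
  rw [chainSum_mul_alternant_eq_sum_ballot (mu := 0) x hlam hanti (fun _ _ => rfl) fun _ _ _ => le_rfl,
    Finset.sum_eq_single (Chain.superstandard hlam hN hanti), Chain.superstandard_wt]
  · intro c hc hne
    refine absurd (Chain.ext ?_) hne
    funext a i
    exact (Finset.mem_filter.mp hc).2.val_eq a i
  · intro h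
    exact absurd (Finset.mem_filter.mpr
      ⟨Finset.mem_univ _, Chain.superstandard_isRowBallot hlam hN hanti⟩) h

end


/-! ### Tableaux and chains -/

/-- A property closed downwards on `[m, n)` holds on an initial segment, which its cardinality
determines. Along a row of a tableau this converts entries into boundaries. -/
theorem lt_add_card_filter_iff {m n : ℕ} {p : ℕ → Prop} [DecidablePred p]
    (hp : ∀ j j', m ≤ j → j < j' → j' < n → p j' → p j) {j : ℕ} (h1 : m ≤ j) (h2 : j < n) :
    j < m + ((Finset.Ico m n).filter p).card ↔ p j := by
  constructor
  · intro h
    by_contra hj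
    have : (Finset.Ico m n).filter p ⊆ Finset.Ico m j := fun j' hj' => by
      obtain ⟨h3, h4⟩ := Finset.mem_filter.mp hj'
      obtain ⟨h5, h6⟩ := Finset.mem_Ico.mp h3
      refine Finset.mem_Ico.mpr ⟨h5, ?_⟩
      by_contra! h7
      rcases h7.lt_or_eq with h8 | rfl
      · exact hj (hp j j' h1 h8 h6 h4)
      · exact hj h4
    have := Finset.card_le_card this
    rw [Nat.card_Ico] at this
    omega
  · intro hj
    have : Finset.Ico m (j + 1) ⊆ (Finset.Ico m n).filter p := fun j' hj' => by
      obtain ⟨h5, h6⟩ := Finset.mem_Ico.mp hj'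
      refine Finset.mem_filter.mpr ⟨Finset.mem_Ico.mpr ⟨h5, by omega⟩, ?_⟩
      rcases (Nat.lt_succ_iff.mp h6).lt_or_eq with h8 | rfl
      · exact hp j' j h5 h8 h2 hj
      · exact hj
    have := Finset.card_le_card this
    rw [Nat.card_Ico] at this
    omega

theorem mem_skew_cells {lam mu : YoungDiagram} {i j : ℕ} :
    (i, j) ∈ lam.cells \ mu.cells ↔ mu.rowLen i ≤ j ∧ j < lam.rowLen i := by
  rw [Finset.mem_sdiff, YoungDiagram.mem_cells, YoungDiagram.mem_cells,
    YoungDiagram.mem_iff_lt_rowLen, YoungDiagram.mem_iff_lt_rowLen, not_lt, and_comm]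

theorem rowLen_le_of_le {lam mu : YoungDiagram} (h : mu ≤ lam) (i : ℕ) :
    mu.rowLen i ≤ lam.rowLen i := by
  by_contra! hlt
  have h1 : (i, lam.rowLen i) ∈ lam := h (YoungDiagram.mem_iff_lt_rowLen.mpr hlt)
  exact lt_irrefl _ (YoungDiagram.mem_iff_lt_rowLen.mp h1)

theorem rowLen_eq_zero {lam : YoungDiagram} {i : ℕ} (h : lam.colLen 0 ≤ i) : lam.rowLen i = 0 := by
  by_contra hne
  have h1 := YoungDiagram.mem_iff_lt_rowLen.mpr (Nat.pos_of_ne_zero hne)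
  exact absurd (YoungDiagram.mem_iff_lt_colLen.mp h1) (not_lt.mpr h)

/-- The tableau `T` and the chain `c` describe the same filling. -/
def Encodes {lam mu : YoungDiagram} {N l : ℕ} (T : SkewSSYT lam mu)
    (c : Chain N l lam.rowLen mu.rowLen) : Prop :=
  ∀ a i j, mu.rowLen i ≤ j → j < lam.rowLen i → (T.entry i j < a ↔ j < c.val a i)

section

variable {lam mu : YoungDiagram} {N l : ℕ}

theorem Chain.le_val (c : Chain N l lam.rowLen mu.rowLen) (a i : ℕ) : mu.rowLen i ≤ c.val a i := by
  rw [← c.zero i]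
  exact c.monotone i (Nat.zero_le a)

/-- The tableau of a chain. -/
def Chain.toTableau (c : Chain N l lam.rowLen mu.rowLen) :
    {T : SkewSSYT lam mu // Encodes T c} := by
  classical
  let e : ℕ → ℕ → ℕ := fun i j =>
    if (i, j) ∈ lam.cells \ mu.cells then sInf {a | j < c.val (a + 1) i} else 0
  have key : ∀ a i j, mu.rowLen i ≤ j → j < lam.rowLen i → (e i j < a ↔ j < c.val a i) := by
    intro a i j h1 h2
    have he : e i j = sInf {a | j < c.val (a + 1) i} := if_pos (mem_skew_cells.mpr ⟨h1, h2⟩)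
    rw [he]
    constructor
    · intro h
      -- The chain has reached `lam` by stage `N`, so the infimum is attained and is not the default
      -- value `0`.
      have hne : {a | j < c.val (a + 1) i}.Nonempty :=
        ⟨N, by rw [Set.mem_ofPred_eq, c.last _ (Nat.le_succ N)]; exact h2⟩
      have : j < c.val (sInf {a | j < c.val (a + 1) i} + 1) i := Nat.sInf_mem hne
      exact this.trans_le (c.monotone i h)
    · intro h
      cases a with
      | zero => rw [c.zero] at h; omega
      | succ a => exact Nat.lt_succ_of_le (Nat.sInf_le h)
  refine ⟨⟨e, fun {i j₁ j₂} hj h1 h2 => ?_, fun {i₁ i₂ j} hi h1 h2 => ?_, fun h => if_neg h⟩, key⟩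
  · have h1 := mem_skew_cells.mp h1
    have h2 := mem_skew_cells.mp h2
    by_contra! hlt
    have h3 := (key _ i j₂ h2.1 h2.2).mp hlt
    exact lt_irrefl _ ((key _ i j₁ h1.1 h1.2).mpr (hj.trans h3))
  · have h1 := mem_skew_cells.mp h1
    have h2 := mem_skew_cells.mp h2
    have h3 := (key _ i₂ j h2.1 h2.2).mp (Nat.lt_succ_self _)
    refine (key _ i₁ j h1.1 h1.2).mpr (h3.trans_le ?_)
    exact (c.anti _ (show i₁ + 1 ≤ i₂ from hi)).trans (c.strip _ i₁)

/-- The chain of a tableau. -/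
def SkewSSYT.toChain (T : SkewSSYT lam mu) (hle : mu ≤ lam) (hl : lam.colLen 0 ≤ l)
    (hT : ∀ i j, (i, j) ∈ lam.cells \ mu.cells → T.entry i j < N) :
    {c : Chain N l lam.rowLen mu.rowLen // Encodes T c} := by
  let v : ℕ → ℕ → ℕ := fun a i =>
    mu.rowLen i + ((Finset.Ico (mu.rowLen i) (lam.rowLen i)).filter fun j => T.entry i j < a).card
  have key : ∀ a i j, mu.rowLen i ≤ j → j < lam.rowLen i → (T.entry i j < a ↔ j < v a i) := by
    intro a i j h1 h2
    refine (lt_add_card_filter_iff (p := fun j => T.entry i j < a) (fun j j' h3 h4 h5 h6 => ?_) h1 h2).symm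
    exact (T.row_weak h4 (mem_skew_cells.mpr ⟨h3, h4.trans h5⟩)
      (mem_skew_cells.mpr ⟨h3.trans h4.le, h5⟩)).trans_lt h6
  have hv : ∀ a i, v a i ≤ lam.rowLen i := fun a i => by
    have := Finset.card_filter_le (Finset.Ico (mu.rowLen i) (lam.rowLen i))
      fun j => T.entry i j < a
    rw [Nat.card_Ico] at this
    have := rowLen_le_of_le hle i
    simp only [v]
    omega
  refine ⟨⟨v, fun i => ?_, fun a ha i => ?_, fun a i => ?_, fun a i => ?_, fun a i hi => ?_⟩, key⟩
  · simp [v]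
  · have := rowLen_le_of_le hle i
    simp only [v]
    rw [Finset.filter_true_of_mem fun j hj => ?_, Nat.card_Ico]
    · omega
    · exact (hT i j (mem_skew_cells.mpr (Finset.mem_Ico.mp hj))).trans_le ha
  · refine Nat.add_le_add_left (Finset.card_le_card (Finset.monotone_filter_right _ ?_)) _
    exact fun j _ hj => Nat.lt_succ_of_lt hj
  -- Otherwise the cell of row `i + 1` in column `v a i` has entry at most `a`. The cell above it
  -- then has entry less than `a`, although `v a i` is the first column of row `i` where this fails.
  · by_contra! hlt
    have h1 : mu.rowLen i ≤ v a i := Nat.le_add_right _ _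
    have h2 := mu.rowLen_anti i (i + 1) (Nat.le_succ i)
    have h3 := lam.rowLen_anti i (i + 1) (Nat.le_succ i)
    have h4 := hv (a + 1) (i + 1)
    have h5 := (key (a + 1) (i + 1) (v a i) (h2.trans h1) (by omega)).mpr hlt
    have h6 := T.col_strict (show i < i + 1 by omega)
      (mem_skew_cells.mpr (⟨h1, by omega⟩ : mu.rowLen i ≤ v a i ∧ v a i < lam.rowLen i))
      (mem_skew_cells.mpr ⟨h2.trans h1, by omega⟩)
    exact lt_irrefl _ ((key a i (v a i) h1 (by omega)).mp (by omega))
  · have := hv a i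
    rw [rowLen_eq_zero (hl.trans hi)] at this
    omega

theorem Encodes.tableau_unique {T T' : SkewSSYT lam mu} {c : Chain N l lam.rowLen mu.rowLen}
    (h : Encodes T c) (h' : Encodes T' c) : T = T' := by
  ext i j
  by_cases hc : (i, j) ∈ lam.cells \ mu.cells
  · obtain ⟨h1, h2⟩ := mem_skew_cells.mp hc
    have e : ∀ a, T.entry i j < a ↔ T'.entry i j < a := fun a =>
      (h a i j h1 h2).trans (h' a i j h1 h2).symm
    have e1 := (e (T.entry i j + 1)).mp (Nat.lt_succ_self _)
    have e2 := (e (T'.entry i j + 1)).mpr (Nat.lt_succ_self _)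
    omega
  · rw [T.zeros hc, T'.zeros hc]

theorem Encodes.chain_unique {T : SkewSSYT lam mu} {c c' : Chain N l lam.rowLen mu.rowLen}
    (h : Encodes T c) (h' : Encodes T c') : c = c' := by
  have key : ∀ c c' : Chain N l lam.rowLen mu.rowLen, Encodes T c → Encodes T c' → ∀ a i,
      c.val a i ≤ c'.val a i := by
    intro c c' h h' a i
    by_contra! hlt
    have h1 := c'.le_val a i
    have h2 := c.le_last a i
    exact lt_irrefl _ ((h' a i _ h1 (by omega)).mp ((h a i _ h1 (by omega)).mpr hlt))
  refine Chain.ext ?_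
  funext a i
  exact le_antisymm (key _ _ h h' a i) (key _ _ h' h a i)

/-- Properties that correspond under the encoding are counted by the same number. -/
theorem card_tableaux_eq_card_chains (hle : mu ≤ lam) (hl : lam.colLen 0 ≤ l)
    (P : SkewSSYT lam mu → Prop) (Q : Chain N l lam.rowLen mu.rowLen → Prop)
    (hP : ∀ T, P T → ∀ i j, (i, j) ∈ lam.cells \ mu.cells → T.entry i j < N)
    (hPQ : ∀ T c, Encodes T c → (P T ↔ Q c)) :
    Nat.card {T // P T} = Nat.card {c // Q c} :=
  Nat.card_congr
    { toFun := fun T => ⟨(T.1.toChain hle hl (hP T.1 T.2)).1,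
        (hPQ _ _ (T.1.toChain hle hl (hP T.1 T.2)).2).mp T.2⟩
      invFun := fun c => ⟨c.1.toTableau.1, (hPQ _ _ c.1.toTableau.2).mpr c.2⟩
      left_inv := fun T => Subtype.ext (Encodes.tableau_unique (Chain.toTableau _).2
        (T.1.toChain hle hl (hP T.1 T.2)).2)
      right_inv := fun c => Subtype.ext (Encodes.chain_unique (SkewSSYT.toChain _ hle hl
        (hP _ ((hPQ _ _ c.1.toTableau.2).mpr c.2))).2 c.1.toTableau.2) }

theorem Encodes.filter_entry_eq {T : SkewSSYT lam mu} {c : Chain N l lam.rowLen mu.rowLen}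
    (h : Encodes T c) (a i : ℕ) :
    (Finset.Ico (mu.rowLen i) (lam.rowLen i)).filter (fun j => T.entry i j = a) =
      Finset.Ico (c.val a i) (c.val (a + 1) i) := by
  ext j
  rw [Finset.mem_filter, Finset.mem_Ico, Finset.mem_Ico]
  have h1 := c.le_val a i
  have h2 := c.le_last (a + 1) i
  constructor
  · rintro ⟨⟨h3, h4⟩, h5⟩
    have h6 := h a i j h3 h4
    have h7 := h (a + 1) i j h3 h4
    omega
  · rintro ⟨h3, h4⟩
    have h6 := h a i j (by omega) (by omega)
    have h7 := h (a + 1) i j (by omega) (by omega)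
    omega

theorem SkewSSYT.content_apply (T : SkewSSYT lam mu) (a : ℕ) :
    T.content a = ∑ c ∈ lam.cells \ mu.cells, if T.entry c.1 c.2 = a then 1 else 0 := by
  classical
  rw [content, Finsupp.finsetSum_apply]
  simp only [Finsupp.single_apply]

theorem Encodes.content_apply {T : SkewSSYT lam mu} {c : Chain N l lam.rowLen mu.rowLen}
    (h : Encodes T c) (hl : lam.colLen 0 ≤ l) (a : ℕ) : T.content a = c.wt a := by
  classical
  rw [T.content_apply, Finset.sum_finset_product' _ (Finset.range l)
    (fun i => Finset.Ico (mu.rowLen i) (lam.rowLen i))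
    (f := fun i j => if T.entry i j = a then 1 else 0)]
  · refine Finset.sum_congr rfl fun i _ => ?_
    rw [← Finset.card_filter, h.filter_entry_eq, Nat.card_Ico]
  · rintro ⟨i, j⟩
    rw [mem_skew_cells, Finset.mem_Ico, Finset.mem_range]
    refine ⟨fun h' => ⟨?_, h'⟩, fun h' => h'.2⟩
    by_contra! hil
    have := rowLen_eq_zero (hl.trans hil)
    simp only at this h'
    omega

theorem SkewSSYT.content_entry_pos (T : SkewSSYT lam mu) {i j : ℕ}
    (h : (i, j) ∈ lam.cells \ mu.cells) : 0 < T.content (T.entry i j) := by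
  rw [T.content_apply]
  exact Finset.sum_pos' (fun _ _ => Nat.zero_le _) ⟨(i, j), h, by simp⟩

/-! ### The reading word -/

/-- One row of a tableau, read from right to left. -/
def SkewSSYT.rowWord (T : SkewSSYT lam mu) (i : ℕ) : List ℕ :=
  ((List.range' (mu.rowLen i) (lam.rowLen i - mu.rowLen i)).map (T.entry i)).reverse

theorem count_map_range' (f : ℕ → ℕ) (a m n : ℕ) :
    ((List.range' m (n - m)).map f).count a = ((Finset.Ico m n).filter fun j => f j = a).card := by
  rw [List.count_eq_countP, List.countP_map, List.countP_eq_length_filter]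
  change _ = Multiset.card (Multiset.filter _ (List.range' m (n - m) : Multiset ℕ))
  rw [Multiset.filter_coe, Multiset.coe_card]
  rfl

theorem Encodes.count_rowWord {T : SkewSSYT lam mu} {c : Chain N l lam.rowLen mu.rowLen}
    (h : Encodes T c) (a i : ℕ) : (T.rowWord i).count a = c.val (a + 1) i - c.val a i := by
  rw [SkewSSYT.rowWord, List.count_reverse, count_map_range', h.filter_entry_eq, Nat.card_Ico]

/-- The letters larger than `a` of a row, read from right to left, come first. -/
theorem Encodes.exists_prefix_rowWord {T : SkewSSYT lam mu}
    {c : Chain N l lam.rowLen mu.rowLen} (h : Encodes T c) (a i : ℕ) :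
    ∃ u, u <+: T.rowWord i ∧ u.count a = 0 ∧ u.count (a + 1) = (T.rowWord i).count (a + 1) := by
  have h1 := c.le_val (a + 1) i
  have h2 := c.le_last (a + 1) i
  have e : T.rowWord i =
      ((List.range' (c.val (a + 1) i) (lam.rowLen i - c.val (a + 1) i)).map (T.entry i)).reverse ++
      ((List.range' (mu.rowLen i) (c.val (a + 1) i - mu.rowLen i)).map (T.entry i)).reverse := by
    rw [← List.reverse_append, ← List.map_append, SkewSSYT.rowWord]
    congr 2
    rw [show lam.rowLen i - mu.rowLen i = (c.val (a + 1) i - mu.rowLen i) +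
      (lam.rowLen i - c.val (a + 1) i) by omega, ← List.range'_append_1]
    rw [show mu.rowLen i + (c.val (a + 1) i - mu.rowLen i) = c.val (a + 1) i by omega]
  refine ⟨_, ⟨_, e.symm⟩, ?_, ?_⟩
  · rw [List.count_reverse, count_map_range', Finset.card_eq_zero, Finset.filter_eq_empty_iff]
    intro j hj hja
    obtain ⟨h3, h4⟩ := Finset.mem_Ico.mp hj
    have := (h (a + 1) i j (by omega) h4).mp (by omega)
    omega
  · rw [e, List.count_append, List.count_reverse (l := List.map (T.entry i) (List.range'
      (mu.rowLen i) _)), count_map_range' _ _ (mu.rowLen i), left_eq_add, Finset.card_eq_zero,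
      Finset.filter_eq_empty_iff]
    intro j hj hja
    obtain ⟨h3, h4⟩ := Finset.mem_Ico.mp hj
    have := (h (a + 1) i j h3 (by omega)).mpr h4
    omega

theorem count_flatMap_range (f : ℕ → List ℕ) (a n : ℕ) :
    ((List.range n).flatMap f).count a = ∑ i ∈ Finset.range n, (f i).count a := by
  induction n with
  | zero => simp
  | succ n ih => rw [List.range_succ, List.flatMap_append, List.count_append, ih,
      Finset.sum_range_succ, List.flatMap_singleton]

theorem flatMap_range_prefix (f : ℕ → List ℕ) {m n : ℕ} (h : m ≤ n) :
    (List.range m).flatMap f <+: (List.range n).flatMap f := by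
  induction n, h using Nat.le_induction with
  | base => exact List.prefix_rfl
  | succ n _ ih =>
    rw [List.range_succ, List.flatMap_append]
    exact ih.trans (List.prefix_append _ _)

theorem SkewSSYT.reverseReadingWord_eq (T : SkewSSYT lam mu) {n : ℕ} (h : lam.colLen 0 ≤ n) :
    T.reverseReadingWord = (List.range n).flatMap T.rowWord := by
  induction n, h using Nat.le_induction with
  | base => rfl
  | succ n hn ih =>
    rw [ih, List.range_succ, List.flatMap_append, List.flatMap_singleton]
    simp [SkewSSYT.rowWord, rowLen_eq_zero hn]

/-- Within a row read from right to left, larger letters come first. The critical prefixes for `a`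
thus consist of full rows followed by the letters exceeding `a` of the next row, and these give the
row inequalities. -/
theorem Encodes.isBallot_iff {T : SkewSSYT lam mu} {c : Chain N l lam.rowLen mu.rowLen}
    (h : Encodes T c) : IsBallot T.reverseReadingWord ↔ c.IsRowBallot := by
  have hc : ∀ a n, ((List.range n).flatMap T.rowWord).count a =
      ∑ r ∈ Finset.range n, (c.val (a + 1) r - c.val a r) := fun a n => by
    rw [count_flatMap_range]
    simp only [h.count_rowWord]
  constructor
  · intro hb a i
    obtain ⟨u, hu, hu0, hu1⟩ := h.exists_prefix_rowWord a i
    -- Padding with empty rows covers the case that row `i` lies below the diagram.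
    rw [T.reverseReadingWord_eq (show lam.colLen 0 ≤ lam.colLen 0 + (i + 1) by omega)] at hb
    have hp : (List.range i).flatMap T.rowWord ++ u <+:
        (List.range (lam.colLen 0 + (i + 1))).flatMap T.rowWord := by
      refine List.IsPrefix.trans ?_ (flatMap_range_prefix T.rowWord (Nat.le_add_left (i + 1) _))
      rw [List.range_succ, List.flatMap_append, List.flatMap_singleton]
      exact (List.prefix_append_right_inj _).mpr hu
    have h1 := hb _ hp a
    rw [List.count_append, List.count_append, hu0, hu1, hc, hc, add_zero, h.count_rowWord] at h1
    rw [Finset.sum_range_succ]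
    exact h1
  · intro hr v hv a
    rw [T.reverseReadingWord_eq le_rfl] at hv
    generalize lam.colLen 0 = n at hv
    induction n with
    | zero =>
      rw [List.range_zero, List.flatMap_nil, List.prefix_nil] at hv
      simp [hv]
    | succ n ih =>
      rw [List.range_succ, List.flatMap_append, List.flatMap_singleton] at hv
      -- Locate the row in which the prefix ends: it contains all earlier rows, and at most this row
      -- in addition.
      rcases List.prefix_or_prefix_of_prefix hv (List.prefix_append _ _) with h1 | h1
      · exact ih h1
      · calc v.count (a + 1)
            ≤ ((List.range n).flatMap T.rowWord ++ T.rowWord n).count (a + 1) :=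
              hv.sublist.count_le _
          _ = ((List.range (n + 1)).flatMap T.rowWord).count (a + 1) := by
              rw [List.range_succ, List.flatMap_append, List.flatMap_singleton]
          _ ≤ ((List.range n).flatMap T.rowWord).count a := by
              rw [hc, hc]; exact hr a n
          _ ≤ v.count a := h1.sublist.count_le _

end


/-! ### Setting all but finitely many variables to zero -/

/-- The monomial `x^d` only involves the first `N` variables. -/
def InFirst (N : ℕ) (d : ℕ →₀ ℕ) : Prop := ∀ i, N ≤ i → d i = 0

theorem inFirst_add {N : ℕ} {d e : ℕ →₀ ℕ} : InFirst N (d + e) ↔ InFirst N d ∧ InFirst N e := by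
  simp only [InFirst, Finsupp.add_apply, Nat.add_eq_zero_iff]
  exact ⟨fun h => ⟨fun i hi => (h i hi).1, fun i hi => (h i hi).2⟩,
    fun h i hi => ⟨h.1 i hi, h.2 i hi⟩⟩

theorem inFirst_mono {N M : ℕ} (h : N ≤ M) {d : ℕ →₀ ℕ} (hd : InFirst N d) : InFirst M d :=
  fun i hi => hd i (h.trans hi)

theorem exists_inFirst (d : ℕ →₀ ℕ) : ∃ N, InFirst N d := by
  refine ⟨d.support.sup id + 1, fun i hi => ?_⟩
  by_contra h
  have := Finset.le_sup (f := id) (Finsupp.mem_support_iff.mpr h)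
  simp only [id] at this
  omega

open Classical in
/-- Setting the variables from `x_N` on to zero. -/
def truncVars (N : ℕ) : MvPowerSeries ℕ ℚ →ₐ[ℚ] MvPowerSeries ℕ ℚ :=
  AlgHom.ofLinearMap
    { toFun := fun f d => if InFirst N d then MvPowerSeries.coeff d f else 0
      map_add' := fun f g => by
        ext d
        change (if InFirst N d then _ else _) = (if InFirst N d then _ else _) +
          (if InFirst N d then _ else (0 : ℚ))
        split_ifs <;> simp
      map_smul' := fun r f => by
        ext d
        change (if InFirst N d then _ else _) = r * (if InFirst N d then _ else (0 : ℚ))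
        split_ifs <;> simp }
    (by
      ext d
      change (if InFirst N d then MvPowerSeries.coeff d 1 else 0) = _
      rw [MvPowerSeries.coeff_one]
      split_ifs with h1 h2 h2
      · rfl
      · rfl
      · subst h2; exact absurd (fun i _ => rfl) h1
      · rfl)
    (fun f g => by
      ext d
      rw [MvPowerSeries.coeff_mul]
      change (if InFirst N d then MvPowerSeries.coeff d (f * g) else 0) =
        ∑ p ∈ Finset.HasAntidiagonal.antidiagonal d,
          (if InFirst N p.1 then MvPowerSeries.coeff p.1 f else 0) *
            (if InFirst N p.2 then MvPowerSeries.coeff p.2 g else 0)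
      split_ifs with h
      · rw [MvPowerSeries.coeff_mul]
        refine Finset.sum_congr rfl fun p hp => ?_
        rw [← Finset.HasAntidiagonal.mem_antidiagonal.mp hp, inFirst_add] at h
        rw [if_pos h.1, if_pos h.2]
      · refine (Finset.sum_eq_zero fun p hp => ?_).symm
        rw [← Finset.HasAntidiagonal.mem_antidiagonal.mp hp, inFirst_add] at h
        by_cases h1 : InFirst N p.1
        · rw [if_neg fun h2 => h ⟨h1, h2⟩, mul_zero]
        · rw [if_neg h1, zero_mul])

open Classical in
theorem coeff_truncVars (N : ℕ) (f : MvPowerSeries ℕ ℚ) (d : ℕ →₀ ℕ) :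
    MvPowerSeries.coeff d (truncVars N f) =
      if InFirst N d then MvPowerSeries.coeff d f else 0 := rfl

/-- Every monomial involves finitely many variables, so identities may be checked in all
sufficiently large finite sets of variables. -/
theorem eq_of_truncVars_eq {f g : MvPowerSeries ℕ ℚ} (M : ℕ)
    (h : ∀ N, M ≤ N → truncVars N f = truncVars N g) : f = g := by
  ext d
  obtain ⟨N, hN⟩ := exists_inFirst d
  have hN' := inFirst_mono (le_max_left N M) hN
  have := congrArg (MvPowerSeries.coeff d) (h _ (le_max_right N M))
  rwa [coeff_truncVars, coeff_truncVars, if_pos hN', if_pos hN'] at this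

/-- The first `N` variables. -/
def varX (N : ℕ) (a : Fin N) : MvPowerSeries ℕ ℚ := MvPowerSeries.X a

open Classical in
-- Double induction along the recursion in the last variable: if `x_N` divides the monomial it is
-- cancelled, otherwise the monomial lies in fewer variables.
theorem coeff_completeH (N r : ℕ) (d : ℕ →₀ ℕ) :
    MvPowerSeries.coeff d (completeH (varX N) r) =
      if InFirst N d ∧ d.degree = r then 1 else 0 := by
  induction N generalizing r d with
  | zero =>
    have h1 : completeH (varX 0) r = if r = 0 then 1 else 0 := by
      rw [completeH, Finset.univ_eq_empty, Finset.prod_empty, PowerSeries.coeff_one]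
    have h2 : InFirst 0 d ↔ d = 0 :=
      ⟨fun h => Finsupp.ext fun i => h i (Nat.zero_le i), fun h i _ => by rw [h]; rfl⟩
    have h3 : InFirst 0 d ∧ d.degree = r ↔ d = 0 ∧ d.degree = r := and_congr_left fun _ => h2
    rw [h1, if_congr h3 rfl rfl]
    by_cases hr : r = 0
    · rw [if_pos hr, MvPowerSeries.coeff_one]
      exact if_congr ⟨fun h => ⟨h, by rw [h, hr, map_zero]⟩, fun h => h.1⟩ rfl rfl
    · rw [if_neg hr, map_zero, if_neg]
      rintro ⟨rfl, h⟩
      exact hr (by rw [← h, map_zero])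
  | succ N ih =>
    induction r generalizing d with
    | zero =>
      rw [completeH_zero, MvPowerSeries.coeff_one]
      refine if_congr ⟨fun h => ?_, fun h => ?_⟩ rfl rfl
      · subst h; exact ⟨fun _ _ => rfl, map_zero _⟩
      · exact (Finsupp.degree_eq_zero_iff d).mp h.2
    | succ r ihr =>
      rw [completeH_succ, map_add]
      change MvPowerSeries.coeff d (MvPowerSeries.X N * _) +
        MvPowerSeries.coeff d (completeH (varX N) (r + 1)) = _
      rw [ih, MvPowerSeries.X, MvPowerSeries.coeff_monomial_mul, one_mul]
      by_cases hd : d N = 0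
      · rw [if_neg, zero_add]
        · refine if_congr (and_congr_left fun _ => ⟨inFirst_mono (Nat.le_succ N), fun h i hi => ?_⟩)
            rfl rfl
          rcases hi.lt_or_eq with h1 | rfl
          · exact h i h1
          · exact hd
        · intro h
          have := h N
          rw [Finsupp.single_eq_same] at this
          omega
      · have hle : Finsupp.single N 1 ≤ d := by
          rw [Finsupp.single_le_iff]; omega
        rw [if_pos hle, ihr, if_neg (fun h : InFirst N d ∧ d.degree = r + 1 => hd (h.1 N le_rfl)), add_zero]
        obtain ⟨e, rfl⟩ := exists_add_of_le hle
        rw [add_tsub_cancel_left]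
        refine if_congr ?_ rfl rfl
        rw [inFirst_add, map_add, Finsupp.degree_single]
        refine ⟨fun h => ⟨⟨fun i hi => Finsupp.single_eq_of_ne (by omega), h.1⟩, by omega⟩,
          fun h => ⟨h.1.2, by omega⟩⟩

theorem coeff_hSym (r : ℕ) (d : ℕ →₀ ℕ) :
    MvPowerSeries.coeff d (hSym r : MvPowerSeries ℕ ℚ) = if d.degree = r then 1 else 0 := rfl

theorem truncVars_hSym (N r : ℕ) :
    truncVars N (hSym r : MvPowerSeries ℕ ℚ) = completeH (varX N) r := by
  classical
  ext d
  rw [coeff_truncVars, coeff_completeH, coeff_hSym, ite_and]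

theorem coeff_chainSum {N l : ℕ} (lam mu : ℕ → ℕ) (d : ℕ →₀ ℕ) :
    MvPowerSeries.coeff d (chainSum (varX N) l lam mu) =
      (Nat.card {c : Chain N l lam mu // ∀ a, c.wt a = d a} : ℚ) := by
  classical
  rw [chainSum, map_sum, Nat.card_eq_fintype_card, Fintype.card_subtype, Finset.card_filter,
    Nat.cast_sum]
  refine Finset.sum_congr rfl fun c _ => ?_
  simp only [varX, MvPowerSeries.X_pow_eq, MvPowerSeries.prod_monomial, Finset.prod_const_one,
    MvPowerSeries.coeff_monomial]
  rw [Nat.cast_ite, Nat.cast_one, Nat.cast_zero]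
  refine if_congr ?_ rfl rfl
  have key : ∀ b, (∑ a : Fin N, Finsupp.single (a : ℕ) (c.wt a)) b = c.wt b := by
    intro b
    rw [Finsupp.finsetSum_apply, Fin.sum_univ_eq_sum_range
      (fun a => (Finsupp.single a (c.wt a)) b) N]
    simp only [Finsupp.single_apply, Finset.sum_ite_eq', Finset.mem_range]
    split_ifs with h
    · rfl
    · rw [c.wt_of_le (by omega)]
  refine ⟨fun h a => by rw [h, key], fun h => Finsupp.ext fun a => by rw [key, h]⟩

theorem SkewSSYT.entry_lt_of_content {lam mu : YoungDiagram} {N : ℕ} {T : SkewSSYT lam mu}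
    (h : ∀ a, N ≤ a → T.content a = 0) (i j : ℕ) (hc : (i, j) ∈ lam.cells \ mu.cells) :
    T.entry i j < N := by
  by_contra! hlt
  have := T.content_entry_pos hc
  rw [h _ hlt] at this
  exact lt_irrefl _ this

theorem truncVars_skewSchur {lam mu : YoungDiagram} (hle : mu ≤ lam) {N l : ℕ}
    (hl : lam.colLen 0 ≤ l) :
    truncVars N (skewSchur lam mu) = chainSum (varX N) l lam.rowLen mu.rowLen := by
  classical
  ext d
  rw [coeff_truncVars, coeff_chainSum]
  split_ifs with hd
  · change (Nat.card {T : SkewSSYT lam mu // T.content = d} : ℚ) = _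
    rw [card_tableaux_eq_card_chains (N := N) hle hl _
      (fun c : Chain N l lam.rowLen mu.rowLen => ∀ a, c.wt a = d a)]
    · rintro T rfl
      exact T.entry_lt_of_content hd
    · intro T c h
      rw [Finsupp.ext_iff]
      simp only [h.content_apply hl]
  · rw [eq_comm, Nat.cast_eq_zero, Nat.card_eq_zero]
    refine Or.inl ⟨fun c => hd fun i hi => ?_⟩
    rw [← c.2, c.1.wt_of_le hi]

/-! ### The Jacobi-Trudi identity -/

/-- `h_{a - b}`, which is `0` for `a < b`. -/
def hSymSub (a b : ℕ) : Sym := if b ≤ a then hSym (a - b) else 0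

theorem truncVars_hSymSub (N a b : ℕ) :
    truncVars N (hSymSub a b : MvPowerSeries ℕ ℚ) = completeHSub (varX N) a b := by
  rw [hSymSub, completeHSub]
  split_ifs
  · exact truncVars_hSym N _
  · exact map_zero _

theorem rowLen_antitone (lam : YoungDiagram) : Antitone lam.rowLen := fun i j h =>
  lam.rowLen_anti i j h

theorem colLen_le_of_le {lam mu : YoungDiagram} (h : mu ≤ lam) : mu.colLen 0 ≤ lam.colLen 0 := by
  by_contra! hlt
  exact lt_irrefl _ (YoungDiagram.mem_iff_lt_colLen.mp (h (YoungDiagram.mem_iff_lt_colLen.mpr hlt)))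

/-- The Jacobi-Trudi identity for skew Schur functions. -/
theorem skewSchur_eq_det {lam mu : YoungDiagram} (hle : mu ≤ lam) {l : ℕ}
    (hl : lam.colLen 0 ≤ l + 1) :
    skewSchur lam mu = ((Matrix.of fun i j => hSymSub (shifted (l + 1) lam.rowLen i)
      (shifted (l + 1) mu.rowLen j)).det : Sym) := by
  refine eq_of_truncVars_eq 0 fun N _ => ?_
  rw [truncVars_skewSchur hle hl, chainSum_eq_det _ _ _ (fun i hi => rowLen_eq_zero (hl.trans hi))
    (rowLen_antitone lam) (fun i hi => rowLen_eq_zero ((colLen_le_of_le hle).trans (hl.trans hi)))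
    (rowLen_antitone mu)]
  have h := AlgHom.map_det ((truncVars N).comp Sym.val) (Matrix.of fun i j =>
    hSymSub (shifted (l + 1) lam.rowLen i) (shifted (l + 1) mu.rowLen j))
  refine Eq.trans ?_ h.symm
  congr 1
  refine Matrix.ext fun i j => ?_
  exact (truncVars_hSymSub N _ _).symm

/-- Symmetry and bounded degree are inherited from the determinant of complete homogeneous
functions. -/
theorem skewSchur_mem {lam mu : YoungDiagram} (hle : mu ≤ lam) : skewSchur lam mu ∈ Sym := by
  rw [skewSchur_eq_det hle (Nat.le_succ _)]
  exact Subtype.property _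


/-! ### Partitions and Young diagrams -/

theorem rowLen_bot : (⊥ : YoungDiagram).rowLen = 0 := by
  funext i
  by_contra h
  exact YoungDiagram.notMem_bot _ (YoungDiagram.mem_iff_lt_rowLen.mpr (Nat.pos_of_ne_zero h))

theorem rowLen_injective : Function.Injective YoungDiagram.rowLen := fun lam mu h => by
  ext ⟨i, j⟩
  rw [YoungDiagram.mem_cells, YoungDiagram.mem_cells, YoungDiagram.mem_iff_lt_rowLen,
    YoungDiagram.mem_iff_lt_rowLen, h]

theorem card_eq_sum_rowLen {lam : YoungDiagram} {l : ℕ} (h : lam.colLen 0 ≤ l) :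
    lam.card = ∑ i ∈ Finset.range l, lam.rowLen i := by
  rw [YoungDiagram.card, Finset.card_eq_sum_ones, Finset.sum_finset_product' lam.cells
    (Finset.range l) (fun i => Finset.range (lam.rowLen i)) (f := fun _ _ => 1)]
  · simp
  · rintro ⟨i, j⟩
    rw [YoungDiagram.mem_cells, YoungDiagram.mem_iff_lt_rowLen, Finset.mem_range, Finset.mem_range]
    refine ⟨fun h' => ⟨?_, h'⟩, fun h' => h'.2⟩
    by_contra! hil
    have := rowLen_eq_zero (h.trans hil)
    simp only at this h'
    omega

theorem card_eq_sum_rowLens (lam : YoungDiagram) : lam.card = lam.rowLens.sum := by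
  rw [card_eq_sum_rowLen le_rfl, YoungDiagram.rowLens, Finset.sum_eq_multiset_sum,
    Finset.range_val, Multiset.range, Multiset.map_coe, Multiset.sum_coe]

theorem colLen_le_card (lam : YoungDiagram) : lam.colLen 0 ≤ lam.card := by
  rw [YoungDiagram.colLen_eq_card]
  exact Finset.card_le_card (Finset.filter_subset _ _)

theorem rowLen_ofRowLens_map {l : ℕ} {w : ℕ → ℕ} (h : ((List.range l).map w).SortedGE) (i : ℕ) :
    (YoungDiagram.ofRowLens _ h).rowLen i = if i < l then w i else 0 := by
  split_ifs with hi
  · have := YoungDiagram.rowLen_ofRowLens (hw := h) ⟨i, by simpa using hi⟩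
    simpa using this
  · by_contra hne
    have h1 := YoungDiagram.mem_iff_lt_rowLen.mpr (Nat.pos_of_ne_zero hne)
    obtain ⟨h2, -⟩ := YoungDiagram.mem_ofRowLens.mp h1
    rw [List.length_map, List.length_range] at h2
    exact hi h2

theorem exists_rowLen_eq {l : ℕ} {w : ℕ → ℕ} (hw : Antitone w) (hl : ∀ i, l ≤ i → w i = 0) :
    ∃ lam : YoungDiagram, lam.rowLen = w := by
  have h : ((List.range l).map w).SortedGE :=
    (List.Pairwise.map (R := (· ≤ ·)) (S := (· ≥ ·)) w (fun _ _ hij => hw hij)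
      List.pairwise_le_range).sortedGE
  refine ⟨YoungDiagram.ofRowLens _ h, ?_⟩
  funext i
  rw [rowLen_ofRowLens_map]
  split_ifs with hi
  · rfl
  · rw [hl i (by omega)]

theorem rowLens_diagram {n : ℕ} (p : n.Partition) :
    (diagram p).rowLens = p.parts.sort (· ≥ ·) :=
  YoungDiagram.rowLens_ofRowLens_eq_self fun _ hx => p.parts_pos ((Multiset.mem_sort _).mp hx)

theorem card_diagram {n : ℕ} (p : n.Partition) : (diagram p).card = n := by
  rw [card_eq_sum_rowLens, rowLens_diagram, ← Multiset.sum_coe, Multiset.sort_eq, p.parts_sum]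

theorem diagram_injective {n : ℕ} : Function.Injective (diagram (n := n)) := fun p q h => by
  have h1 := congrArg (fun lam : YoungDiagram => (lam.rowLens : Multiset ℕ)) h
  simp only [rowLens_diagram, Multiset.sort_eq] at h1
  exact Nat.Partition.ext h1

theorem exists_diagram_eq {n : ℕ} {lam : YoungDiagram} (h : lam.card = n) :
    ∃ p : n.Partition, diagram p = lam := by
  refine ⟨⟨lam.rowLens, fun hi => lam.pos_of_mem_rowLens _ (Multiset.mem_coe.mp hi), ?_⟩, ?_⟩
  · rw [Multiset.sum_coe, ← card_eq_sum_rowLens, h]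
  · refine YoungDiagram.equivListRowLens.injective (Subtype.ext ?_)
    change (diagram _).rowLens = lam.rowLens
    rw [rowLens_diagram]
    exact List.mergeSort_eq_self _ lam.rowLens_sorted.pairwise

/-! ### The Littlewood-Richardson rule -/

namespace Chain

variable {N l : ℕ} {lam mu : ℕ → ℕ}

theorem sum_wt (c : Chain N l lam mu) :
    ∑ a ∈ Finset.range N, c.wt a + ∑ i ∈ Finset.range l, mu i = ∑ i ∈ Finset.range l, lam i := by
  have h : ∀ M, ∑ a ∈ Finset.range M, c.wt a + ∑ i ∈ Finset.range l, mu i =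
      ∑ i ∈ Finset.range l, c.val M i := fun M => by
    induction M with
    | zero => simp [c.zero]
    | succ M ih =>
      rw [Finset.sum_range_succ, ← c.wt_add_sum M, ← ih]
      ring
  rw [h]
  exact Finset.sum_congr rfl fun i _ => c.last N le_rfl i

theorem IsRowBallot.wt_antitone {c : Chain N l lam mu} (h : c.IsRowBallot) : Antitone c.wt := by
  refine antitone_nat_of_succ_le fun a => ?_
  have h1 := h.isGood 0 a
  simp only [colWt, Nat.max_zero] at h1
  exact h1

end Chain

instance : IsDomain (MvPowerSeries ℕ ℚ) := NoZeroDivisors.to_isDomain _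

instance : CharZero (MvPowerSeries ℕ ℚ) := algebraRat.charZero _

theorem varX_injective (N : ℕ) : Function.Injective (varX N) := fun _ _ h =>
  Fin.ext (MvPowerSeries.X_inj.mp h)

theorem alternant_varX_ne_zero (N : ℕ) : alternant (varX N) (addRho 0) ≠ 0 :=
  alternant_rho_ne_zero (varX_injective N)

open Classical in
theorem lrCoeff_eq_card {lam mu nu : YoungDiagram} (hle : mu ≤ lam) {N l : ℕ}
    (hl : lam.colLen 0 ≤ l) (hN : nu.colLen 0 ≤ N) :
    lrCoeff lam mu nu = ((Finset.univ.filter fun c : Chain N l lam.rowLen mu.rowLen =>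
      c.IsRowBallot).filter fun c => c.wt = nu.rowLen).card := by
  rw [lrCoeff, card_tableaux_eq_card_chains (N := N) hle hl _
    (fun c : Chain N l lam.rowLen mu.rowLen => c.wt = nu.rowLen ∧ c.IsRowBallot),
    Nat.card_eq_fintype_card, Fintype.card_subtype, Finset.filter_filter]
  · simp only [and_comm]
  · exact fun T hT => T.entry_lt_of_content fun a ha => by
      rw [hT.1, rowLen_eq_zero (hN.trans ha)]
  · intro T c h
    rw [h.isBallot_iff, funext_iff]
    simp only [h.content_apply hl]

theorem truncVars_schur_mul_alternant {nu : YoungDiagram} {N : ℕ} (hN : nu.colLen 0 ≤ N) :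
    truncVars N (schur nu) * alternant (varX N) (addRho 0) =
      alternant (varX N) (addRho nu.rowLen) := by
  rw [schur, truncVars_skewSchur bot_le (Nat.le_succ _), rowLen_bot]
  exact chainSum_straight_mul_alternant _ (fun i hi => rowLen_eq_zero (by omega))
    (fun i hi => rowLen_eq_zero (hN.trans hi)) (rowLen_antitone nu)

/-- The Littlewood-Richardson rule. -/
theorem skewSchur_eq_sum_lrCoeff {lam mu : YoungDiagram} (hle : mu ≤ lam) {n : ℕ}
    (hn : lam.card = mu.card + n) :
    skewSchur lam mu =
      ∑ ν : n.Partition, (lrCoeff lam mu (diagram ν) : ℚ) • schur (diagram ν) := by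
  classical
  -- With at least `n` variables every partition of `n` has at most `N` parts, so the bialternant
  -- formula applies to each summand. Multiplication by the nonzero `a_ρ` reduces the rule to
  -- alternants.
  refine eq_of_truncVars_eq n fun N hN => mul_right_cancel₀ (alternant_varX_ne_zero N) ?_
  have hcol : ∀ ν : n.Partition, (diagram ν).colLen 0 ≤ N := fun ν =>
    (colLen_le_card _).trans ((card_diagram ν).le.trans hN)
  have hmu : mu.colLen 0 ≤ lam.colLen 0 + 1 := (colLen_le_of_le hle).trans (Nat.le_succ _)
  rw [truncVars_skewSchur hle (Nat.le_succ _), chainSum_mul_alternant_eq_sum_ballot _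
    (fun i hi => rowLen_eq_zero (by omega)) (rowLen_antitone lam)
    (fun i hi => rowLen_eq_zero (hmu.trans hi)) (rowLen_antitone mu), map_sum, Finset.sum_mul]
  have hterm : ∀ ν : n.Partition, truncVars N ((lrCoeff lam mu (diagram ν) : ℚ) •
      schur (diagram ν)) * alternant (varX N) (addRho 0) =
      ∑ c : Chain N (lam.colLen 0 + 1) lam.rowLen mu.rowLen with c.IsRowBallot,
        if c.wt = (diagram ν).rowLen then alternant (varX N) (addRho c.wt) else 0 := fun ν => by
    rw [map_smul, smul_mul_assoc, truncVars_schur_mul_alternant (hcol ν),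
      lrCoeff_eq_card (N := N) hle (Nat.le_succ _) (hcol ν), ← Finset.sum_filter,
      Finset.sum_congr rfl fun c hc => by rw [(Finset.mem_filter.mp hc).2], Finset.sum_const,
      Nat.cast_smul_eq_nsmul]
  rw [Finset.sum_congr rfl fun ν _ => hterm ν, Finset.sum_comm]
  refine Finset.sum_congr rfl fun c hc => ?_
  have hc' : c.IsRowBallot := (Finset.mem_filter.mp hc).2
  -- The weight of a ballot chain is one partition of `n`, so the chain is counted in exactly one of
  -- the coefficients.
  obtain ⟨nu, hnu⟩ := exists_rowLen_eq hc'.wt_antitone fun a ha => c.wt_of_le ha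
  have hnuN : nu.colLen 0 ≤ N := by
    by_contra! hlt
    have h1 := YoungDiagram.mem_iff_lt_rowLen.mp (YoungDiagram.mem_iff_lt_colLen.mpr hlt)
    rw [hnu, c.wt_of_le le_rfl] at h1
    exact lt_irrefl _ h1
  have hcard : nu.card = n := by
    have h1 := c.sum_wt
    rw [← card_eq_sum_rowLen hmu, ← card_eq_sum_rowLen (Nat.le_succ _), ← hnu,
      ← card_eq_sum_rowLen hnuN] at h1
    omega
  obtain ⟨p, rfl⟩ := exists_diagram_eq hcard
  rw [Finset.sum_eq_single p, if_pos hnu.symm]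
  · intro q _ hq
    exact if_neg fun h => hq (diagram_injective (rowLen_injective (h.symm.trans hnu.symm)))
  · exact fun h => absurd (Finset.mem_univ _) h


/-! ### Coefficients of symmetric functions -/

theorem natCard_fiber (d : ℕ →₀ ℕ) {v : ℕ} (hv : v ≠ 0) :
    Nat.card {i // d i = v} = (exponents d).count v := by
  classical
  rw [exponents, Multiset.count_map]
  refine Nat.subtype_card (d.support.filter fun i => v = d i) fun i => ?_
  rw [Finset.mem_filter, Finsupp.mem_support_iff]
  exact ⟨fun h => h.2.symm, fun h => ⟨h ▸ hv, h.symm⟩⟩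

/-- Match the positions with equal exponent. For a nonzero exponent they are finite in number,
equally many on both sides; for the exponent `0` they are countably infinite on both sides. -/
theorem exists_perm_of_exponents_eq {d e : ℕ →₀ ℕ} (h : exponents d = exponents e) :
    ∃ σ : Equiv.Perm ℕ, Finsupp.equivMapDomain σ e = d := by
  have key : ∀ v, Nonempty ({i // e i = v} ≃ {i // d i = v}) := by
    intro v
    by_cases hv : v = 0
    · have hinf : ∀ f : ℕ →₀ ℕ, Infinite {i // f i = v} := fun f => by
        have h1 := (f.support.finite_toSet).infinite_compl
        refine Set.infinite_coe_iff.mpr (h1.mono fun i hi => ?_)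
        rw [hv]
        exact Finsupp.notMem_support_iff.mp hi
      have := hinf d
      have := hinf e
      exact nonempty_equiv_of_countable
    · have hfin : ∀ f : ℕ →₀ ℕ, Finite {i // f i = v} := fun f =>
        Set.finite_coe_iff.mpr (f.support.finite_toSet.subset fun i (hi : f i = v) =>
          Finsupp.mem_support_iff.mpr (hi ▸ hv))
      have := hfin d
      have := hfin e
      rw [← Finite.card_eq, natCard_fiber _ hv, natCard_fiber _ hv, h]
  let g : ∀ v, {i // e i = v} ≃ {i // d i = v} := fun v => (key v).some
  let σ : Equiv.Perm ℕ :=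
    (Equiv.sigmaFiberEquiv e).symm.trans
      ((Equiv.sigmaCongrRight g).trans (Equiv.sigmaFiberEquiv d))
  have hσ : ∀ i, d (σ i) = e i := fun i => (g (e i) ⟨i, rfl⟩).2
  refine ⟨σ, Finsupp.ext fun i => ?_⟩
  rw [Finsupp.equivMapDomain_apply, ← hσ, Equiv.apply_symm_apply]

theorem coeff_eq_of_exponents_eq (f : Sym) {d e : ℕ →₀ ℕ} (h : exponents d = exponents e) :
    MvPowerSeries.coeff d (f : MvPowerSeries ℕ ℚ) =
      MvPowerSeries.coeff e (f : MvPowerSeries ℕ ℚ) := by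
  obtain ⟨σ, rfl⟩ := exists_perm_of_exponents_eq h
  exact coeff_equivMapDomain f σ e

/-- The exponent vector whose entries are the parts of a partition. -/
def rowVector (lam : YoungDiagram) : ℕ →₀ ℕ where
  support := Finset.range (lam.colLen 0)
  toFun := lam.rowLen
  mem_support_toFun i := by
    rw [Finset.mem_range, ← YoungDiagram.mem_iff_lt_colLen, YoungDiagram.mem_iff_lt_rowLen,
      Nat.pos_iff_ne_zero]

theorem exponents_rowVector (lam : YoungDiagram) :
    exponents (rowVector lam) = (lam.rowLens : Multiset ℕ) := rfl

theorem degree_rowVector (lam : YoungDiagram) : (rowVector lam).degree = lam.card := by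
  rw [← exponents_sum, exponents_rowVector, Multiset.sum_coe, card_eq_sum_rowLens]

theorem rowLens_coe_injective {lam mu : YoungDiagram}
    (h : (lam.rowLens : Multiset ℕ) = (mu.rowLens : Multiset ℕ)) : lam = mu :=
  YoungDiagram.equivListRowLens.injective <| Subtype.ext <|
    (Multiset.coe_eq_coe.mp h).eq_of_pairwise (fun _ _ _ _ h1 h2 => le_antisymm h2 h1)
      lam.rowLens_sorted.pairwise mu.rowLens_sorted.pairwise

theorem exists_rowLens_eq {s : Multiset ℕ} (h : ∀ x ∈ s, 0 < x) :
    ∃ lam : YoungDiagram, (lam.rowLens : Multiset ℕ) = s := by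
  refine ⟨YoungDiagram.ofRowLens (s.sort (· ≥ ·)) (s.pairwise_sort (· ≥ ·)).sortedGE, ?_⟩
  rw [YoungDiagram.rowLens_ofRowLens_eq_self fun x hx => h x ((Multiset.mem_sort _).mp hx),
    Multiset.sort_eq]

theorem exists_exponents_eq (d : ℕ →₀ ℕ) :
    ∃ lam : YoungDiagram, exponents d = exponents (rowVector lam) := by
  obtain ⟨lam, h⟩ := exists_rowLens_eq (s := exponents d) fun x hx => by
    obtain ⟨i, hi, rfl⟩ := Multiset.mem_map.mp hx
    exact Nat.pos_of_ne_zero (Finsupp.mem_support_iff.mp hi)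
  exact ⟨lam, h.symm⟩

/-- The coefficient of the monomials of type `lam`. -/
def coeffAt (lam : YoungDiagram) : Sym →ₗ[ℚ] ℚ :=
  (MvPowerSeries.coeff (rowVector lam)).comp Sym.val.toLinearMap

theorem sym_ext {f g : Sym} (h : ∀ lam, coeffAt lam f = coeffAt lam g) : f = g := by
  ext d
  obtain ⟨lam, hlam⟩ := exists_exponents_eq d
  rw [coeff_eq_of_exponents_eq f hlam, coeff_eq_of_exponents_eq g hlam]
  exact h lam

open Classical in
theorem coeffAt_mSym (lam mu : YoungDiagram) :
    coeffAt lam (mSym mu) = if lam = mu then 1 else 0 := by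
  change (if exponents (rowVector lam) = (mu.rowLens : Multiset ℕ) then (1 : ℚ) else 0) = _
  exact if_congr ⟨fun h => rowLens_coe_injective h, fun h => h ▸ rfl⟩ rfl rfl

open Classical in
/-- The partitions of size at most `M`. -/
def diagramsUpTo (M : ℕ) : Finset YoungDiagram :=
  (Finset.range (M + 1)).biUnion fun n => Finset.univ.image (diagram (n := n))

theorem mem_diagramsUpTo {M : ℕ} {lam : YoungDiagram} :
    lam ∈ diagramsUpTo M ↔ lam.card ≤ M := by
  classical
  rw [diagramsUpTo, Finset.mem_biUnion]
  constructor
  · rintro ⟨n, hn, h⟩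
    obtain ⟨p, -, rfl⟩ := Finset.mem_image.mp h
    rw [card_diagram]
    exact Nat.lt_succ_iff.mp (Finset.mem_range.mp hn)
  · intro h
    obtain ⟨p, hp⟩ := exists_diagram_eq (lam := lam) rfl
    exact ⟨_, Finset.mem_range.mpr (Nat.lt_succ_of_le h),
      Finset.mem_image.mpr ⟨p, Finset.mem_univ _, hp⟩⟩

theorem eq_sum_mSym {f : Sym} {M : ℕ}
    (hM : ∀ d : ℕ →₀ ℕ, M < d.degree → MvPowerSeries.coeff d (f : MvPowerSeries ℕ ℚ) = 0) :
    f = ∑ lam ∈ diagramsUpTo M, coeffAt lam f • mSym lam := by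
  classical
  refine sym_ext fun mu => ?_
  rw [map_sum]
  simp only [map_smul, coeffAt_mSym, smul_eq_mul, mul_ite, mul_one, mul_zero, Finset.sum_ite_eq]
  split_ifs with h
  · rfl
  · exact hM _ (by rw [degree_rowVector]; exact not_le.mp fun h' => h (mem_diagramsUpTo.mpr h'))

theorem span_mSym : Submodule.span ℚ (Set.range mSym) = ⊤ := by
  refine eq_top_iff.mpr fun f _ => ?_
  obtain ⟨M, hM⟩ := f.2.1
  rw [eq_sum_mSym hM]
  exact Submodule.sum_mem _ fun lam _ => Submodule.smul_mem _ _ (Submodule.subset_span ⟨lam, rfl⟩)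

theorem linearIndependent_mSym : LinearIndependent ℚ mSym := by
  classical
  refine linearIndependent_iff'.mpr fun s g h lam hlam => ?_
  have h1 := congrArg (coeffAt lam) h
  rw [map_sum, map_zero] at h1
  simp only [map_smul, coeffAt_mSym, smul_eq_mul, mul_ite, mul_one, mul_zero,
    Finset.sum_ite_eq, if_pos hlam] at h1
  exact h1

/-! ### Schur functions form a basis -/

/-- The Schur function as an element of `Sym`. -/
def schurSym (lam : YoungDiagram) : Sym := ⟨schur lam, skewSchur_mem bot_le⟩

theorem coeff_schur_eq_zero {lam : YoungDiagram} {d : ℕ →₀ ℕ} (h : d.degree ≠ lam.card) :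
    MvPowerSeries.coeff d (schur lam) = 0 := by
  change (Nat.card {T : SkewSSYT lam ⊥ // T.content = d} : ℚ) = 0
  rw [Nat.cast_eq_zero, Nat.card_eq_zero]
  refine Or.inl ⟨fun T => h ?_⟩
  rw [← T.2, SkewSSYT.content, map_sum]
  simp only [Finsupp.degree_single, Finset.sum_const, smul_eq_mul, mul_one]
  rw [YoungDiagram.cells_bot, Finset.sdiff_empty]

theorem addRho_comp_rev_strictMono {N : ℕ} (lam : YoungDiagram) :
    StrictMono (addRho lam.rowLen ∘ Fin.rev : Fin N → ℕ) := fun i j hij => by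
  have h1 := rowLen_antitone lam (show (j.rev : ℕ) ≤ i.rev from Fin.rev_le_rev.mpr hij.le)
  have h2 : (i : ℕ) < j := hij
  simp only [addRho, Function.comp_apply, Fin.val_rev] at *
  omega

theorem addRho_rowLen_injective {N : ℕ} {lam mu : YoungDiagram} (hlam : lam.colLen 0 ≤ N)
    (hmu : mu.colLen 0 ≤ N)
    (h : (addRho lam.rowLen : Fin N → ℕ) = addRho mu.rowLen) : lam = mu := by
  refine rowLen_injective (funext fun i => ?_)
  by_cases hi : i < N
  · have := congrFun h ⟨i, hi⟩
    simpa [addRho] using this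
  · rw [rowLen_eq_zero (by omega), rowLen_eq_zero (by omega)]

theorem coeff_alternant {N : ℕ} (v w : Fin N → ℕ) :
    MvPowerSeries.coeff (∑ a : Fin N, Finsupp.single (a : ℕ) (w a)) (alternant (varX N) v) =
      (Matrix.of fun i j => if w i = v j then (1 : ℚ) else 0).det := by
  classical
  rw [alternant, Matrix.det_apply, Matrix.det_apply, map_sum]
  refine Finset.sum_congr rfl fun σ _ => ?_
  rw [Units.smul_def, Units.smul_def, map_zsmul]
  congr 1
  simp only [Matrix.of_apply, varX, MvPowerSeries.X_pow_eq, MvPowerSeries.prod_monomial,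
    Finset.prod_const_one, MvPowerSeries.coeff_monomial]
  rw [Finset.prod_ite_zero, Finset.prod_const_one]
  have key : ∀ (u : Fin N → ℕ) (b : Fin N),
      (∑ a : Fin N, Finsupp.single (a : ℕ) (u a)) (b : ℕ) = u b := fun u b => by
    rw [Finsupp.finsetSum_apply, Finset.sum_eq_single b, Finsupp.single_eq_same]
    · exact fun a _ hab => Finsupp.single_eq_of_ne fun h => hab (Fin.ext h.symm)
    · exact fun h => absurd (Finset.mem_univ _) h
  have e : ∑ i : Fin N, Finsupp.single ((σ i : Fin N) : ℕ) (v i) =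
      ∑ a : Fin N, Finsupp.single (a : ℕ) (v (σ.symm a)) := by
    rw [← Equiv.sum_comp σ fun a => Finsupp.single (a : ℕ) (v (σ.symm a))]
    simp only [Equiv.symm_apply_apply]
  have hiff : ∑ a : Fin N, Finsupp.single (a : ℕ) (w a) =
      ∑ a : Fin N, Finsupp.single ((σ a : Fin N) : ℕ) (v a) ↔
      ∀ i ∈ Finset.univ, w (σ i) = v i := by
    rw [e]
    refine ⟨fun h i _ => ?_, fun h => Finset.sum_congr rfl fun a _ => ?_⟩
    · rw [← key w, h, key, Equiv.symm_apply_apply]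
    · have := h (σ.symm a) (Finset.mem_univ _)
      rw [Equiv.apply_symm_apply] at this
      rw [this]
  by_cases H : ∀ i ∈ Finset.univ, w (σ i) = v i
  · rw [if_pos H, if_pos (hiff.mpr H)]
  · rw [if_neg H, if_neg fun h => H (hiff.mp h)]

/-- The exponents of `μ + ρ` are strictly decreasing, so of all monomials of its alternant only the
one of the identity permutation has decreasing exponents. -/
theorem coeff_alternant_addRho {N : ℕ} {lam mu : YoungDiagram} (hlam : lam.colLen 0 ≤ N)
    (hmu : mu.colLen 0 ≤ N) [Decidable (lam = mu)] :
    MvPowerSeries.coeff (∑ a : Fin N, Finsupp.single (a : ℕ) (addRho lam.rowLen a))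
      (alternant (varX N) (addRho mu.rowLen)) = if lam = mu then 1 else 0 := by
  rw [coeff_alternant, ← Matrix.det_submatrix_equiv_self Fin.revPerm]
  refine (det_ite_eq (addRho_comp_rev_strictMono lam) (addRho_comp_rev_strictMono mu)).trans ?_
  refine if_congr ⟨fun h => addRho_rowLen_injective hlam hmu (funext fun i => ?_),
    fun h => by rw [h]⟩ rfl rfl
  simpa using congrFun h i.rev

/-- After multiplication by `a_ρ` in enough variables, the coefficient of `x^{λ+ρ}` isolates the
coefficient of `s_λ` in a linear relation. -/
theorem linearIndependent_schurSym : LinearIndependent ℚ schurSym := by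
  classical
  refine linearIndependent_iff'.mpr fun s g h lam hlam => ?_
  obtain ⟨N, hN⟩ := (s.image fun mu : YoungDiagram => mu.colLen 0).exists_le
  replace hN : ∀ mu ∈ s, mu.colLen 0 ≤ N := fun mu hmu =>
    hN _ (Finset.mem_image_of_mem (fun mu : YoungDiagram => mu.colLen 0) hmu)
  have h1 := congrArg (fun f : Sym => MvPowerSeries.coeff
    (∑ a : Fin N, Finsupp.single (a : ℕ) (addRho lam.rowLen a))
    ((truncVars N).comp Sym.val f * alternant (varX N) (addRho 0))) h
  simp only [map_sum, map_smul, map_zero, zero_mul, Finset.sum_mul, smul_mul_assoc] at h1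
  rw [Finset.sum_eq_single lam] at h1
  · change g lam • MvPowerSeries.coeff _ (truncVars N (schur lam) * _) = 0 at h1
    rw [truncVars_schur_mul_alternant (hN lam hlam),
      coeff_alternant_addRho (hN lam hlam) (hN lam hlam), if_pos rfl, smul_eq_mul, mul_one] at h1
    exact h1
  · intro mu hmu hne
    change g mu • MvPowerSeries.coeff _ (truncVars N (schur mu) * _) = 0
    rw [truncVars_schur_mul_alternant (hN mu hmu), coeff_alternant_addRho (hN lam hlam) (hN mu hmu),
      if_neg hne.symm, smul_zero]
  · exact fun h' => absurd hlam h'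

/-! ### Dimension counts for two families with the same finite index set. -/

section LinearAlgebra

variable {K V ι : Type*} [Field K] [AddCommGroup V] [Module K V] [Fintype ι] {b w : ι → V}

theorem span_eq_of_linearIndependent (hw : LinearIndependent K w)
    (h : ∀ i, w i ∈ Submodule.span K (Set.range b)) :
    Submodule.span K (Set.range w) = Submodule.span K (Set.range b) := by
  have := FiniteDimensional.span_of_finite K (Set.finite_range b)
  have := FiniteDimensional.span_of_finite K (Set.finite_range w)
  refine Submodule.eq_of_le_of_finrank_le (Submodule.span_le.mpr ?_) ?_
  · rintro _ ⟨i, rfl⟩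
    exact h i
  · rw [finrank_span_eq_card hw]
    exact finrank_range_le_card b

theorem linearIndependent_of_mem_span (hw : LinearIndependent K w)
    (h : ∀ i, w i ∈ Submodule.span K (Set.range b)) : LinearIndependent K b := by
  refine linearIndependent_iff_card_le_finrank_span.mpr ?_
  rw [Set.finrank, ← span_eq_of_linearIndependent hw h, finrank_span_eq_card hw]

end LinearAlgebra

/-- In degree at most `|lam|`, Schur functions are independent, lie in the span of the monomial
functions, and are equally many. -/
theorem mSym_mem_span_schurSym (lam : YoungDiagram) :
    mSym lam ∈ Submodule.span ℚ (Set.range schurSym) := by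
  let D := {mu : YoungDiagram // mu ∈ diagramsUpTo lam.card}
  have h := span_eq_of_linearIndependent (ι := D) (b := fun mu => mSym mu.1)
    (linearIndependent_schurSym.comp (Subtype.val : D → YoungDiagram) Subtype.val_injective)
    fun mu => by
      rw [Function.comp_apply, eq_sum_mSym (f := schurSym mu.1) (M := lam.card) fun d hd =>
        coeff_schur_eq_zero (ne_of_gt ((mem_diagramsUpTo.mp mu.2).trans_lt hd))]
      exact Submodule.sum_mem _ fun nu hnu => Submodule.smul_mem _ _
        (Submodule.subset_span ⟨⟨nu, hnu⟩, rfl⟩)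
  have h1 : mSym lam ∈ Submodule.span ℚ (Set.range fun mu : D => mSym mu.1) :=
    Submodule.subset_span ⟨⟨lam, mem_diagramsUpTo.mpr le_rfl⟩, rfl⟩
  rw [← h] at h1
  refine Submodule.span_mono ?_ h1
  rintro _ ⟨mu, rfl⟩
  exact ⟨mu.1, rfl⟩

/-! ### Complete homogeneous symmetric functions form a basis -/

theorem hSym_zero : hSym 0 = 1 := by
  classical
  ext d
  rw [coeff_hSym]
  change _ = MvPowerSeries.coeff d 1
  rw [MvPowerSeries.coeff_one]
  exact if_congr (Finsupp.degree_eq_zero_iff d) rfl rfl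

theorem hPart_eq_prod (lam : YoungDiagram) :
    hPart lam = ((lam.rowLens : Multiset ℕ).map hSym).prod := by
  rw [Multiset.map_coe, Multiset.prod_coe]; rfl

theorem exists_hPart_eq_one : ∃ lam, hPart lam = 1 ∧ lam.rowLens = [] := by
  obtain ⟨lam, h⟩ := exists_rowLens_eq (s := 0) (by simp)
  exact ⟨lam, by rw [hPart_eq_prod, h]; simp, by simpa using h⟩

theorem exists_hPart_eq_hSym (r : ℕ) (hr : 0 < r) :
    ∃ lam, hPart lam = hSym r ∧ lam.rowLens = [r] := by
  obtain ⟨lam, h⟩ := exists_rowLens_eq (s := {r}) (by simpa using hr)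
  exact ⟨lam, by rw [hPart_eq_prod, h]; simp, by simpa using h⟩

theorem exists_hPart_eq_mul (lam mu : YoungDiagram) :
    ∃ nu, hPart nu = hPart lam * hPart mu ∧
      (nu.rowLens : Multiset ℕ) = (lam.rowLens : Multiset ℕ) + (mu.rowLens : Multiset ℕ) := by
  obtain ⟨nu, h⟩ := exists_rowLens_eq
    (s := (lam.rowLens : Multiset ℕ) + (mu.rowLens : Multiset ℕ)) fun x hx => by
      rcases Multiset.mem_add.mp hx with h | h
      · exact lam.pos_of_mem_rowLens x h
      · exact mu.pos_of_mem_rowLens x h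
  exact ⟨nu, by rw [hPart_eq_prod, h, hPart_eq_prod, hPart_eq_prod, Multiset.map_add,
    Multiset.prod_add], h⟩

theorem adjoin_le_span_hPart :
    Subalgebra.toSubmodule (Algebra.adjoin ℚ (Set.range hSym)) ≤
      Submodule.span ℚ (Set.range hPart) := by
  rw [Algebra.adjoin_eq_span]
  refine Submodule.span_mono fun f hf => ?_
  induction hf using Submonoid.closure_induction with
  | mem x hx =>
    obtain ⟨r, rfl⟩ := hx
    rcases Nat.eq_zero_or_pos r with rfl | hr
    · obtain ⟨lam, h, -⟩ := exists_hPart_eq_one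
      exact ⟨lam, by rw [h, hSym_zero]⟩
    · obtain ⟨lam, h, -⟩ := exists_hPart_eq_hSym r hr
      exact ⟨lam, h⟩
  | one =>
    obtain ⟨lam, h, -⟩ := exists_hPart_eq_one
    exact ⟨lam, h⟩
  | mul x y _ _ hx hy =>
    obtain ⟨lam, rfl⟩ := hx
    obtain ⟨mu, rfl⟩ := hy
    obtain ⟨nu, h, -⟩ := exists_hPart_eq_mul lam mu
    exact ⟨nu, h⟩

theorem schurSym_mem_adjoin (lam : YoungDiagram) :
    schurSym lam ∈ Algebra.adjoin ℚ (Set.range hSym) := by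
  have h : schurSym lam = (Matrix.of fun i j => hSymSub
      (shifted (lam.colLen 0 + 1) lam.rowLen i)
      (shifted (lam.colLen 0 + 1) (⊥ : YoungDiagram).rowLen j)).det :=
    Subtype.ext (skewSchur_eq_det bot_le (Nat.le_succ _))
  rw [h, Matrix.det_apply]
  refine Subalgebra.sum_mem _ fun σ _ => ?_
  rw [Units.smul_def]
  refine Subalgebra.zsmul_mem _ (Subalgebra.prod_mem _ fun i _ => ?_) _
  rw [Matrix.of_apply, hSymSub]
  split_ifs
  · exact Algebra.subset_adjoin ⟨_, rfl⟩
  · exact Subalgebra.zero_mem _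

/-- Monomial functions are combinations of Schur functions, and these are polynomials in the `h_r`
by Jacobi-Trudi. -/
theorem span_hPart : Submodule.span ℚ (Set.range hPart) = ⊤ := by
  refine eq_top_iff.mpr ?_
  rw [← span_mSym, Submodule.span_le]
  rintro _ ⟨lam, rfl⟩
  refine Submodule.span_le.mpr ?_ (mSym_mem_span_schurSym lam)
  rintro _ ⟨mu, rfl⟩
  exact adjoin_le_span_hPart (schurSym_mem_adjoin mu)

/-- Symmetric functions whose monomials all have degree `n`. -/
def IsHomog (n : ℕ) (f : Sym) : Prop :=
  ∀ d : ℕ →₀ ℕ, d.degree ≠ n → MvPowerSeries.coeff d (f : MvPowerSeries ℕ ℚ) = 0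

theorem IsHomog.mul {m n : ℕ} {f g : Sym} (hf : IsHomog m f) (hg : IsHomog n g) :
    IsHomog (m + n) (f * g) := by
  classical
  intro d hd
  change MvPowerSeries.coeff d ((f : MvPowerSeries ℕ ℚ) * (g : MvPowerSeries ℕ ℚ)) = 0
  rw [MvPowerSeries.coeff_mul]
  refine Finset.sum_eq_zero fun p hp => ?_
  rw [← Finset.HasAntidiagonal.mem_antidiagonal.mp hp, map_add] at hd
  by_cases h : p.1.degree = m
  · rw [hg p.2 (by omega), mul_zero]
  · rw [hf p.1 h, zero_mul]

theorem isHomog_hSym (r : ℕ) : IsHomog r (hSym r) := fun _ hd => if_neg hd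

theorem isHomog_hPart (lam : YoungDiagram) : IsHomog lam.card (hPart lam) := by
  rw [card_eq_sum_rowLens, hPart]
  induction lam.rowLens with
  | nil =>
    rw [List.map_nil, List.prod_nil, List.sum_nil, ← hSym_zero]
    exact isHomog_hSym 0
  | cons a l ih =>
    rw [List.map_cons, List.prod_cons, List.sum_cons]
    exact (isHomog_hSym a).mul ih

/-- The part of degree at most `M`. -/
def degTrunc (M : ℕ) : Sym →ₗ[ℚ] Sym where
  toFun f := ⟨fun d => if d.degree ≤ M then MvPowerSeries.coeff d (f : MvPowerSeries ℕ ℚ) else 0,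
    mem_Sym_of_coeff M (fun _ hd => if_neg (not_le.mpr hd)) fun σ d => by
      change (if (Finsupp.equivMapDomain σ d).degree ≤ M then
        MvPowerSeries.coeff (Finsupp.equivMapDomain σ d) (f : MvPowerSeries ℕ ℚ) else 0) =
        if d.degree ≤ M then MvPowerSeries.coeff d (f : MvPowerSeries ℕ ℚ) else 0
      rw [degree_equivMapDomain, coeff_equivMapDomain]⟩
  map_add' f g := by
    ext d
    change (if d.degree ≤ M then _ else _) = (if d.degree ≤ M then _ else _) +
      (if d.degree ≤ M then _ else (0 : ℚ))
    split_ifs <;> simp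
  map_smul' r f := by
    ext d
    change (if d.degree ≤ M then _ else _) = r * (if d.degree ≤ M then _ else (0 : ℚ))
    split_ifs <;> simp

theorem coeff_degTrunc (M : ℕ) (f : Sym) (d : ℕ →₀ ℕ) :
    MvPowerSeries.coeff d (degTrunc M f : MvPowerSeries ℕ ℚ) =
      if d.degree ≤ M then MvPowerSeries.coeff d (f : MvPowerSeries ℕ ℚ) else 0 := rfl

theorem degTrunc_of_isHomog {M n : ℕ} {f : Sym} (hf : IsHomog n f) :
    degTrunc M f = if n ≤ M then f else 0 := by
  ext d
  rw [coeff_degTrunc]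
  by_cases hd : d.degree = n
  · rw [hd]
    split_ifs <;> rfl
  · rw [hf d hd, ite_self]
    split_ifs
    · exact (hf d hd).symm
    · rfl

theorem isHomog_mSym (lam : YoungDiagram) : IsHomog lam.card (mSym lam) := fun d hd => by
  classical
  change (if exponents d = (lam.rowLens : Multiset ℕ) then (1 : ℚ) else 0) = 0
  refine if_neg fun h => hd ?_
  rw [← exponents_sum, h, Multiset.sum_coe, card_eq_sum_rowLens]

/-- Truncating by degree keeps or kills each homogeneous `h_mu`, so an element of degree at most `M`
needs only the `h_mu` with `|mu| ≤ M`. This supplies the finite spanning set for the dimension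
count. -/
theorem degTrunc_mem_span (M : ℕ) (f : Sym) :
    degTrunc M f ∈ Submodule.span ℚ (Set.range fun mu : {mu // mu ∈ diagramsUpTo M} =>
      hPart mu.1) := by
  have hf : f ∈ Submodule.span ℚ (Set.range hPart) := span_hPart ▸ Submodule.mem_top
  induction hf using Submodule.span_induction with
  | mem x hx =>
    obtain ⟨mu, rfl⟩ := hx
    rw [degTrunc_of_isHomog (isHomog_hPart mu)]
    split_ifs with h
    · exact Submodule.subset_span ⟨⟨mu, mem_diagramsUpTo.mpr h⟩, rfl⟩
    · exact Submodule.zero_mem _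
  | zero => rw [map_zero]; exact Submodule.zero_mem _
  | add x y _ _ hx hy => rw [map_add]; exact Submodule.add_mem _ hx hy
  | smul r x _ hx => rw [map_smul]; exact Submodule.smul_mem _ _ hx

/-- In degree at most `M`, the `h_mu` span the independent `m_mu` and are equally many, so they are
independent too. -/
theorem linearIndependent_hPart : LinearIndependent ℚ hPart := by
  classical
  refine linearIndependent_iff'.mpr fun s => ?_
  obtain ⟨M, hM⟩ := (s.image YoungDiagram.card).exists_le
  have h : LinearIndepOn ℚ hPart (diagramsUpTo M : Set YoungDiagram) := by
    refine linearIndependent_of_mem_span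
      (linearIndependent_mSym.comp (Subtype.val : {mu // mu ∈ diagramsUpTo M} → YoungDiagram)
        Subtype.val_injective) fun mu => ?_
    have h1 := degTrunc_mem_span M (mSym mu.1)
    rwa [degTrunc_of_isHomog (isHomog_mSym mu.1), if_pos (mem_diagramsUpTo.mp mu.2)] at h1
  exact linearIndepOn_finset_iff.mp (h.mono fun mu hmu => mem_diagramsUpTo.mpr
    (hM _ (Finset.mem_image_of_mem _ hmu)))


/-! ### The Hall inner product -/

/-- The basis of complete homogeneous symmetric functions. -/
def hBasis : Module.Basis YoungDiagram ℚ Sym :=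
  Module.Basis.mk linearIndependent_hPart span_hPart.ge

theorem hBasis_apply (lam : YoungDiagram) : hBasis lam = hPart lam :=
  Module.Basis.mk_apply _ _ lam

/-- The Hall inner product. -/
def hallForm : LinearMap.BilinForm ℚ Sym := (hBasis.constr ℚ coeffAt).flip

theorem hallForm_hPart (f : Sym) (mu : YoungDiagram) : hallForm f (hPart mu) = coeffAt mu f := by
  rw [hallForm, LinearMap.flip_apply, ← hBasis_apply, Module.Basis.constr_basis]

theorem isHallForm_hallForm : IsHallForm hallForm := fun lam mu => by
  classical
  rw [hallForm_hPart, coeffAt_mSym]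
  exact if_congr eq_comm rfl rfl

theorem IsHallForm.apply_hPart {B : LinearMap.BilinForm ℚ Sym} (hB : IsHallForm B) (f : Sym)
    (mu : YoungDiagram) : B f (hPart mu) = coeffAt mu f := by
  classical
  have h : B.flip (hPart mu) = coeffAt mu := LinearMap.ext_on span_mSym <| by
    rintro _ ⟨lam, rfl⟩
    change B (mSym lam) (hPart mu) = _
    rw [hB, coeffAt_mSym]
    exact if_congr eq_comm rfl rfl
  exact congrArg (fun F : Sym →ₗ[ℚ] ℚ => F f) h

theorem IsHallForm.eq_hallForm {B : LinearMap.BilinForm ℚ Sym} (hB : IsHallForm B) :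
    B = hallForm := by
  refine LinearMap.ext fun f => hBasis.ext fun mu => ?_
  rw [hBasis_apply, hB.apply_hPart, hallForm_hPart]

/-- Nondegeneracy: pairing with `m_lam` is the coordinate at `h_lam`. -/
theorem IsHallForm.eq_of_apply_eq {B : LinearMap.BilinForm ℚ Sym} (hB : IsHallForm B) {g g' : Sym}
    (h : ∀ f, B f g = B f g') : g = g' := by
  classical
  have key : ∀ lam, B (mSym lam) = hBasis.coord lam := fun lam => hBasis.ext fun mu => by
    rw [Module.Basis.coord_apply, Module.Basis.repr_self, hBasis_apply, hB,
      Finsupp.single_apply]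
    exact if_congr eq_comm rfl rfl
  refine hBasis.repr.injective (Finsupp.ext fun lam => ?_)
  have := h (mSym lam)
  rwa [key, Module.Basis.coord_apply, Module.Basis.coord_apply] at this

/-! ### The adjoint of the partition division map -/

/-- The linear map with `h_lam ↦ h_{k lam}`. -/
def dilateLin (k : ℕ) : Sym →ₗ[ℚ] Sym :=
  hBasis.constr ℚ fun lam => ((lam.rowLens : Multiset ℕ).map fun r => hSym (k * r)).prod

theorem dilateLin_hPart (k : ℕ) (lam : YoungDiagram) :
    dilateLin k (hPart lam) = ((lam.rowLens : Multiset ℕ).map fun r => hSym (k * r)).prod := by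
  rw [dilateLin, ← hBasis_apply, Module.Basis.constr_basis]

theorem dilateLin_hPart_mul (k : ℕ) (lam mu : YoungDiagram) :
    dilateLin k (hPart lam * hPart mu) = dilateLin k (hPart lam) * dilateLin k (hPart mu) := by
  obtain ⟨nu, h1, h2⟩ := exists_hPart_eq_mul lam mu
  rw [← h1, dilateLin_hPart, dilateLin_hPart, dilateLin_hPart, h2, Multiset.map_add,
    Multiset.prod_add]

/-- The algebra homomorphism with `h_r ↦ h_{kr}`. -/
def dilateHom (k : ℕ) : Sym →ₐ[ℚ] Sym :=
  AlgHom.ofLinearMap (dilateLin k)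
    (by
      obtain ⟨lam, h1, h2⟩ := exists_hPart_eq_one
      rw [← h1, dilateLin_hPart, h2, h1]
      simp)
    (fun x y => by
      -- Multiplicativity is bilinear, so it is extended from the basis `h_lam` one argument at a
      -- time.
      have h1 : ∀ lam, (dilateLin k).comp (LinearMap.mulLeft ℚ (hPart lam)) =
          (LinearMap.mulLeft ℚ (dilateLin k (hPart lam))).comp (dilateLin k) := fun lam =>
        hBasis.ext fun mu => by
          rw [hBasis_apply]
          exact dilateLin_hPart_mul k lam mu
      have h2 : (dilateLin k).comp (LinearMap.mulRight ℚ y) =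
          (LinearMap.mulRight ℚ (dilateLin k y)).comp (dilateLin k) := hBasis.ext fun lam => by
        rw [hBasis_apply]
        exact congrArg (fun F : Sym →ₗ[ℚ] Sym => F y) (h1 lam)
      exact congrArg (fun F : Sym →ₗ[ℚ] Sym => F x) h2)

theorem dilateHom_hPart (k : ℕ) (lam : YoungDiagram) :
    dilateHom k (hPart lam) = ((lam.rowLens : Multiset ℕ).map fun r => hSym (k * r)).prod :=
  dilateLin_hPart k lam

theorem dilateHom_hSym (k r : ℕ) : dilateHom k (hSym r) = hSym (k * r) := by
  rcases Nat.eq_zero_or_pos r with rfl | hr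
  · rw [Nat.mul_zero, hSym_zero, map_one]
  · obtain ⟨lam, h1, h2⟩ := exists_hPart_eq_hSym r hr
    rw [← h1, dilateHom_hPart, h2]
    simp

theorem eq_dilateHom_iff (k : ℕ) (χ : Sym →ₐ[ℚ] Sym) :
    (∀ r, χ (hSym r) = hSym (k * r)) ↔ χ = dilateHom k := by
  refine ⟨fun h => ?_, fun h r => by rw [h, dilateHom_hSym]⟩
  have h1 : χ.toLinearMap = (dilateHom k).toLinearMap := hBasis.ext fun lam => by
    rw [hBasis_apply, AlgHom.toLinearMap_apply, AlgHom.toLinearMap_apply, dilateHom_hPart,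
      hPart_eq_prod, map_multiset_prod, Multiset.map_map]
    simp only [Function.comp_apply, h]
  exact AlgHom.toLinearMap_injective h1

/-- For `g = h_mu` both sides are the coefficient of `x^{k mu}` in `f`. -/
theorem IsHallForm.apply_dilateHom {B : LinearMap.BilinForm ℚ Sym} (hB : IsHallForm B) {k : ℕ}
    (hk : 0 < k) (f g : Sym) : B (rowMap k hk f) g = B f (dilateHom k g) := by
  have h : B (rowMap k hk f) = (B f).comp (dilateHom k).toLinearMap := hBasis.ext fun mu => by
    rw [hBasis_apply, hB.apply_hPart, LinearMap.comp_apply, AlgHom.toLinearMap_apply,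
      dilateHom_hPart]
    obtain ⟨nu, hnu⟩ := exists_rowLens_eq (s := (mu.rowLens : Multiset ℕ).map (k * ·))
      fun x hx => by
        obtain ⟨y, hy, rfl⟩ := Multiset.mem_map.mp hx
        exact Nat.mul_pos hk (mu.pos_of_mem_rowLens y hy)
    have e : ((mu.rowLens : Multiset ℕ).map fun r => hSym (k * r)).prod = hPart nu := by
      rw [hPart_eq_prod, hnu, Multiset.map_map]; rfl
    rw [e, hB.apply_hPart]
    change MvPowerSeries.coeff (k • rowVector mu) (f : MvPowerSeries ℕ ℚ) = _
    refine coeff_eq_of_exponents_eq f ?_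
    rw [exponents_nsmul k hk, exponents_rowVector, exponents_rowVector, hnu]
  exact congrArg (fun F : Sym →ₗ[ℚ] ℚ => F g) h

theorem IsHallForm.isAdjointPair_iff {B : LinearMap.BilinForm ℚ Sym} (hB : IsHallForm B) {k : ℕ}
    (hk : 0 < k) (ψ : Sym →ₗ[ℚ] Sym) :
    LinearMap.IsAdjointPair B B (rowMap k hk) ψ ↔ ψ = (dilateHom k).toLinearMap := by
  constructor
  · intro h
    refine LinearMap.ext fun g => hB.eq_of_apply_eq fun f => ?_
    rw [← h f g, hB.apply_dilateHom hk]
    rfl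
  · rintro rfl f g
    exact hB.apply_dilateHom hk f g

/-! ### The image of skew Schur functions -/

/-- Positivity of `k` keeps the convention of zero for negative indices: `k b ≤ k a` exactly when `b
≤ a`. -/
theorem dilateHom_hSymSub {k : ℕ} (hk : 0 < k) (a b : ℕ) :
    dilateHom k (hSymSub a b) = hSymSub (k * a) (k * b) := by
  rw [hSymSub, hSymSub, if_congr (Nat.mul_le_mul_left_iff hk) rfl rfl, apply_ite (dilateHom k),
    dilateHom_hSym, map_zero, Nat.mul_sub]

theorem rowLen_dilateShift (k l : ℕ) (mu : YoungDiagram) (i : ℕ) :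
    (dilateShift k l mu).rowLen i =
      if i < l then k * mu.rowLen i + (k - 1) * (l - 1 - i) else 0 :=
  rowLen_ofRowLens_map _ i

theorem colLen_dilateShift_le (k l : ℕ) (mu : YoungDiagram) :
    (dilateShift k l mu).colLen 0 ≤ l := by
  by_contra! h
  have h1 := YoungDiagram.mem_iff_lt_rowLen.mp (YoungDiagram.mem_iff_lt_colLen.mpr h)
  rw [rowLen_dilateShift, if_neg (lt_irrefl _)] at h1
  exact lt_irrefl _ h1

theorem dilateShift_mono {k l : ℕ} {lam mu : YoungDiagram} (h : mu ≤ lam) :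
    dilateShift k l mu ≤ dilateShift k l lam := by
  rintro ⟨i, j⟩ hij
  have h1 := YoungDiagram.mem_iff_lt_rowLen.mp hij
  refine YoungDiagram.mem_iff_lt_rowLen.mpr (h1.trans_le ?_)
  rw [rowLen_dilateShift, rowLen_dilateShift]
  split_ifs
  · exact Nat.add_le_add_right (Nat.mul_le_mul_left k (rowLen_le_of_le h i)) _
  · exact le_rfl

theorem card_dilateShift (k : ℕ) {l : ℕ} {mu : YoungDiagram} (h : mu.colLen 0 ≤ l) :
    (dilateShift k l mu).card =
      k * mu.card + ∑ i ∈ Finset.range l, (k - 1) * (l - 1 - i) := by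
  rw [card_eq_sum_rowLen (colLen_dilateShift_le k l mu), card_eq_sum_rowLen h, Finset.mul_sum,
    ← Finset.sum_add_distrib]
  exact Finset.sum_congr rfl fun i hi => by
    rw [rowLen_dilateShift, if_pos (Finset.mem_range.mp hi)]

/-- The identity `(kμ + (k-1)ρ) + ρ = k(μ + ρ)`, which dictates the shift by `(k-1)ρ`. -/
theorem shifted_dilateShift {k l : ℕ} (hk : 0 < k) (mu : YoungDiagram) (i : Fin (l + 1)) :
    shifted (l + 1) (dilateShift k (l + 1) mu).rowLen i = k * shifted (l + 1) mu.rowLen i := by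
  obtain ⟨m, rfl⟩ : ∃ m, k = m + 1 := ⟨k - 1, by omega⟩
  rw [shifted, rowLen_dilateShift, if_pos i.rev.isLt, shifted, Nat.add_sub_cancel,
    show l + 1 - 1 - (i.rev : ℕ) = i by rw [Fin.val_rev]; omega]
  ring

theorem dilateHom_skewSchur_succ {k : ℕ} (hk : 0 < k) {lam mu : YoungDiagram} (hle : mu ≤ lam)
    {l : ℕ} (hl : lam.colLen 0 ≤ l + 1) :
    (dilateHom k ⟨skewSchur lam mu, skewSchur_mem hle⟩ : MvPowerSeries ℕ ℚ) =
      skewSchur (dilateShift k (l + 1) lam) (dilateShift k (l + 1) mu) := by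
  rw [skewSchur_eq_det (dilateShift_mono hle) (colLen_dilateShift_le k (l + 1) lam)]
  refine congrArg Subtype.val ?_
  have e : (⟨skewSchur lam mu, skewSchur_mem hle⟩ : Sym) = (Matrix.of fun i j =>
      hSymSub (shifted (l + 1) lam.rowLen i) (shifted (l + 1) mu.rowLen j)).det :=
    Subtype.ext (skewSchur_eq_det hle hl)
  rw [e, AlgHom.map_det]
  congr 1
  refine Matrix.ext fun i j => ?_
  rw [Matrix.of_apply, shifted_dilateShift hk, shifted_dilateShift hk, ← dilateHom_hSymSub hk]
  rfl

theorem dilateHom_skewSchur {k : ℕ} (hk : 0 < k) {lam mu : YoungDiagram} (hle : mu ≤ lam) :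
    (dilateHom k ⟨skewSchur lam mu, skewSchur_mem hle⟩ : MvPowerSeries ℕ ℚ) =
      skewSchur (dilateShift k (lam.colLen 0) lam) (dilateShift k (lam.colLen 0) mu) := by
  rcases Nat.eq_zero_or_pos (lam.colLen 0) with h0 | hpos
  -- Jacobi-Trudi is stated for at least one row. For the empty partition one zero row may be added,
  -- since its entry of `ρ` is `0`.
  · have h1 : ∀ nu : YoungDiagram, nu.colLen 0 ≤ 0 → dilateShift k 1 nu = dilateShift k 0 nu :=
      fun nu hnu => rowLen_injective <| funext fun i => by
        rw [rowLen_dilateShift, rowLen_dilateShift, rowLen_eq_zero (hnu.trans (Nat.zero_le i))]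
        split_ifs <;> simp_all
    rw [h0, ← h1 lam h0.le, ← h1 mu ((colLen_le_of_le hle).trans h0.le)]
    exact dilateHom_skewSchur_succ hk hle (l := 0) (by omega)
  · obtain ⟨l, hl⟩ : ∃ l, lam.colLen 0 = l + 1 := ⟨lam.colLen 0 - 1, by omega⟩
    rw [hl]
    exact dilateHom_skewSchur_succ hk hle hl.le

/-- The shift `(k-1)ρ` adds the same number of cells to both shapes, so the size of the skew shape
is `k n`. -/
theorem dilateHom_skewSchur_eq_sum {k : ℕ} (hk : 0 < k) {lam mu : YoungDiagram} (hle : mu ≤ lam)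
    {n : ℕ} (hn : lam.card = mu.card + n) :
    (dilateHom k ⟨skewSchur lam mu, skewSchur_mem hle⟩ : MvPowerSeries ℕ ℚ) =
      ∑ ν : (k * n).Partition, (lrCoeff (dilateShift k (lam.colLen 0) lam)
        (dilateShift k (lam.colLen 0) mu) (diagram ν) : ℚ) • schur (diagram ν) := by
  rw [dilateHom_skewSchur hk hle]
  refine skewSchur_eq_sum_lrCoeff (dilateShift_mono hle) ?_
  rw [card_dilateShift k le_rfl, card_dilateShift k (colLen_le_of_le hle), hn]
  ring

end SymF
end

theorem mainTheorem4 :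
    -- the Hall inner product exists and is unique
    (∃! B : LinearMap.BilinForm ℚ SymF.Sym, SymF.IsHallForm B) ∧
    ∀ B : LinearMap.BilinForm ℚ SymF.Sym, SymF.IsHallForm B →
    ∀ (k : ℕ) (hk : 0 < k), ∃ φ : SymF.Sym →ₐ[ℚ] SymF.Sym,
      -- `φ` is the adjoint of `ρ_k` with respect to the Hall inner product
      (∀ ψ : SymF.Sym →ₗ[ℚ] SymF.Sym,
        LinearMap.IsAdjointPair B B (SymF.rowMap k hk) ψ ↔ ψ = φ.toLinearMap) ∧
      -- `φ` is the ring map with `h_r ↦ h_{kr}`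
      (∀ χ : SymF.Sym →ₐ[ℚ] SymF.Sym, (∀ r : ℕ, χ (SymF.hSym r) = SymF.hSym (k * r)) ↔ χ = φ) ∧
      -- skew Schur functions
      (∀ (n : ℕ) (lam mu : YoungDiagram), mu ≤ lam → lam.card = mu.card + n →
        ∃ hs : SymF.skewSchur lam mu ∈ SymF.Sym,
          (φ ⟨SymF.skewSchur lam mu, hs⟩ : MvPowerSeries ℕ ℚ) =
            SymF.skewSchur (SymF.dilateShift k (lam.colLen 0) lam)
              (SymF.dilateShift k (lam.colLen 0) mu) ∧
          (φ ⟨SymF.skewSchur lam mu, hs⟩ : MvPowerSeries ℕ ℚ) =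
            ∑ ν : (k * n).Partition,
              (SymF.lrCoeff (SymF.dilateShift k (lam.colLen 0) lam)
                (SymF.dilateShift k (lam.colLen 0) mu) (SymF.diagram ν) : ℚ) •
                SymF.schur (SymF.diagram ν)) ∧
      -- the special case of Schur functions
      (∀ (n : ℕ) (lam : YoungDiagram), lam.card = n →
        ∃ hs : SymF.schur lam ∈ SymF.Sym,
          (φ ⟨SymF.schur lam, hs⟩ : MvPowerSeries ℕ ℚ) =
            ∑ ν : (k * n).Partition,
              (SymF.lrCoeff (SymF.dilateShift k (lam.colLen 0) lam)
                (SymF.dilateShift k (lam.colLen 0) ⊥) (SymF.diagram ν) : ℚ) •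
                SymF.schur (SymF.diagram ν)) := by
  refine ⟨⟨SymF.hallForm, SymF.isHallForm_hallForm, fun B hB => hB.eq_hallForm⟩,
    fun B hB k hk => ⟨SymF.dilateHom k, hB.isAdjointPair_iff hk, SymF.eq_dilateHom_iff k,
      fun n lam mu hle hn => ⟨SymF.skewSchur_mem hle, SymF.dilateHom_skewSchur hk hle,
        SymF.dilateHom_skewSchur_eq_sum hk hle hn⟩,
      fun n lam hn => ⟨SymF.skewSchur_mem bot_le, SymF.dilateHom_skewSchur_eq_sum hk bot_le ?_⟩⟩⟩
  rw [hn, YoungDiagram.card, YoungDiagram.cells_bot, Finset.card_empty, Nat.zero_add]
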